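/- Let $A$ be a finite alphabet and let $\mu$ be a positive Bernoulli measure over $A$, given by letter weights $\mu(a)>0$ with $\sum_{a\in A}\mu(a)=1$; for a finite word $w=a_0\cdots a_{k-1}$ put $\mu(w)=\prod_{j<k}\mu(a_j)$. For finite words $u,w$ with $|u|\le |w|$, let $\mathrm{freq}(u,w)$ be the number of positions at which $u$ occurs in $w$ (overlaps allowed), divided by $|w|-|u|+1$. A sequence $X=X(0)X(1)\cdots\in A^\omega$ is \emph{$\mu$-normal} if $\lim_{n\to\infty}\mathrm{freq}(w,X(0)\cdots X(n))=\mu(w)$ for every finite word $w$, and \emph{$\mu$-balanced} if this holds for every word $w$ consisting of a single letter. A \emph{probabilistic selector} is a tuple $\mathcal S=(Q,A,q_I,\delta,S)$, where $Q$ is a finite set of states, $q_I\in Q$, $\delta$ assigns to each $(q,a)\in Q\times A$ a probability distribution on $Q$ (with arbitrary real probabilities), and $S\subseteq Q$. On input $X\in A^\omega$ its run is the random sequence of states $q_0=q_I$, $q_{n+1}=\delta_{n+1}(q_n,X(n))$, where the $\delta_n(r,b)$ ($n\in\mathbb N$, $r\in Q$, $b\in A$) are independent random variables, $\delta_n(r,b)$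 having distribution $\delta(r,b)$. The subsequence of $X$ selected by $\mathcal S$ consists of the letters $X(n)$ with $q_n\in S$, in increasing order of $n$; it is a random finite or infinite sequence. \textbf{Theorem (Agafonov's theorem for PFA).} For every $X\in A^\omega$ the following are equivalent: (i) $X$ is $\mu$-normal; (ii) for every probabilistic selector $\mathcal S$, almost surely the subsequence of $X$ selected by $\mathcal S$ is either finite or $\mu$-balanced; (iii) for every probabilistic selector $\mathcal S$, almost surely the subsequence of $X$ selected by $\mathcal S$ is either finite or $\mu$-normal. -/

import Mathlib

namespace PFA

/-- The number of occurrences of the word `u` in the word `w`, i.e. the number of positions `i`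
with `i + |u| ≤ |w|` at which `u` can be read in `w`. -/
noncomputable def nbocc {A : Type*} (u w : List A) : ℕ :=
  open Classical in
  ((Finset.range (w.length + 1)).filter
    (fun i => i + u.length ≤ w.length ∧ (w.drop i).take u.length = u)).card

/-- The frequency of occurrence of `u` in `w` (only meaningful when `|u| ≤ |w|`). -/
noncomputable def freq {A : Type*} (u w : List A) : ℝ :=
  (nbocc u w : ℝ) / ((w.length : ℝ) - (u.length : ℝ) + 1)

/-- The word `X(0) X(1) ⋯ X(n)`. -/
def initialWord {A : Type*} (X : ℕ → A) (n : ℕ) : List A :=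
  (List.range (n + 1)).map X

/-- The word `u` has asymptotic frequency `f` in the infinite sequence `X`. -/
def HasFreq {A : Type*} (u : List A) (X : ℕ → A) (f : ℝ) : Prop :=
  Filter.Tendsto (fun n => freq u (initialWord X n)) Filter.atTop (nhds f)

/-- The Bernoulli weight of a word: the product of the weights of its letters. -/
def wordWeight {A : Type*} (μ : A → ℝ) (w : List A) : ℝ :=
  (w.map μ).prod

/-- Every letter has in `X` the asymptotic frequency prescribed by `μ`. -/
def IsBalanced {A : Type*} (μ : A → ℝ) (X : ℕ → A) : Prop :=
  ∀ a : A, HasFreq [a] X (μ a)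

/-- Every finite word has in `X` the asymptotic frequency prescribed by `μ`. -/
def IsNormal {A : Type*} (μ : A → ℝ) (X : ℕ → A) : Prop :=
  ∀ w : List A, HasFreq w X (wordWeight μ w)

/-- A probabilistic selector with state set `Q` over the alphabet `A`: a probabilistic automaton
together with a set of selecting states. (Finiteness of `Q` and `A` is required where it is
used.) -/
structure ProbSelector (A Q : Type*) where
  /-- the initial state -/
  init : Q
  /-- the transition probabilities -/
  trans : Q → A → PMF Q
  /-- the selecting states -/
  sel : Set Q

namespace ProbSelector

variable {A Q : Type*}

/-- The joint law of the family of independent random transitions `δ_n(r, b)`, indexed by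
`n : ℕ`, `r : Q`, `b : A`, where `δ_n(r, b)` has distribution `trans r b`. A point `ω` of the
underlying space `ℕ × Q × A → Q` gives the values `ω (n, r, b)` of all these variables. -/
noncomputable def transitionLaw [MeasurableSpace Q] (S : ProbSelector A Q) :
    MeasureTheory.Measure (ℕ × Q × A → Q) :=
  MeasureTheory.Measure.infinitePi
    (fun i : ℕ × Q × A => (S.trans i.2.1 i.2.2).toMeasure)

/-- The state reached after reading the first `n` letters of `X`, when `ω` gives the outcomes of
the random transitions. -/
def state (S : ProbSelector A Q) (X : ℕ → A) (ω : ℕ × Q × A → Q) : ℕ → Q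
  | 0 => S.init
  | n + 1 => ω (n + 1, S.state X ω n, X n)

/-- The set of positions `n` for which the letter `X n` is selected: those where the state reached
before reading `X n` is a selecting state. -/
def selectedPositions (S : ProbSelector A Q) (X : ℕ → A) (ω : ℕ × Q × A → Q) : Set ℕ :=
  {n | S.state X ω n ∈ S.sel}

/-- The selected subsequence, as an infinite sequence: the letters of `X` at the selected positions,
in increasing order of position. It is used only when infinitely many positions are selected. -/
noncomputable def selected (S : ProbSelector A Q) (X : ℕ → A) (ω : ℕ × Q × A → Q) : ℕ → A :=
  fun k => X (Nat.nth (fun n => n ∈ S.selectedPositions X ω) k)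

/-- Almost surely, the subsequence of `X` selected by `S` is finite or has the property `P`. -/
def AlmostSurelyFiniteOr [MeasurableSpace Q] (S : ProbSelector A Q) (X : ℕ → A)
    (P : (ℕ → A) → Prop) : Prop :=
  ∀ᵐ ω ∂S.transitionLaw, (S.selectedPositions X ω).Finite ∨ P (S.selected X ω)

end ProbSelector

end PFA

/-! A sequence is normal as soon as, for every word `v` occurring infinitely often, the letters that
follow `v` have the conditional frequencies `μ a`: multiplying along `v` gives the frequencies of
words (`isNormal_of_ratio`). This settles (ii) ⇒ (i), since a deterministic automaton can select
exactly the letters that follow `v`. For (i) ⇒ (iii), pair the state of the selector with the last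
`K` selected letters. This is again a finite chain driven by `X`, and it suffices that any set `T`
of its states, if visited infinitely often, reads each letter `a` with frequency `μ a`
(`IsDrivenChain.ae_finite_or_tendsto_ratio`).

Two estimates give this. First, for a `μ`-centred letter function `c`, the averages of `c (X n)`
over the times spent in `T` are negligible (`IsDrivenChain.ae_tendsto_avg_disc`). A strong law for
orthogonal variables replaces the random visits in a window of length `l` by their conditional
expectations given the state at its start. The resulting expected discrepancy depends only on that
state and on the word in the window. For a `μ`-random word it is a martingale with second moment at
most `l`, so it is typically of order `√l`, and normality of `X` transfers this bound to the windows
of `X`.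

Second, `T` must be visited with positive lower density (`IsDrivenChain.ae_eventually_le_avg_ind`).
Let `H` be `T` together with the states that cannot reach `T`. Some part of `H` is reachable from
everywhere, so one fixed word visits `H` with probability bounded below from every state, and
normality makes that word frequent. A path that visits `T` infinitely often almost surely never
meets a state unable to reach `T`, so its visits to `H` are visits to `T`. Dividing the first
estimate by this density gives the ratio. -/

namespace PFA

/-! ### Counting functions of sets of positions. -/

/-- The number of `i < n` with `P i`. -/
noncomputable def hits (P : ℕ → Prop) (n : ℕ) : ℕ :=
  open Classical in Nat.count P n

lemma hits_zero (P : ℕ → Prop) : hits P 0 = 0 := by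
  simp [hits]

open Classical in
lemma hits_succ (P : ℕ → Prop) (n : ℕ) : hits P (n + 1) = hits P n + if P n then 1 else 0 := by
  simp [hits, Nat.count_succ]

open Classical in
lemma hits_eq_sum (P : ℕ → Prop) (n : ℕ) :
    (hits P n : ℝ) = ∑ i ∈ Finset.range n, if P i then (1 : ℝ) else 0 := by
  induction n with
  | zero => simp [hits]
  | succ n ih => rw [hits_succ, Finset.sum_range_succ, ← ih]; push_cast; rfl

lemma hits_mono_pred {P P' : ℕ → Prop} (h : ∀ k, P k → P' k) (n : ℕ) : hits P n ≤ hits P' n := by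
  classical
  simpa [hits] using Nat.count_mono_left (fun k _ => h k)

lemma hits_monotone (P : ℕ → Prop) : Monotone (hits P) := by
  classical
  intro a b h
  simpa [hits] using Nat.count_monotone P h

lemma hits_le_card_of_finite {P : ℕ → Prop} (h : {k | P k}.Finite) (n : ℕ) :
    hits P n ≤ h.toFinset.card := by
  classical
  rw [hits, Nat.count_eq_card_filter_range]
  apply Finset.card_le_card
  intro k hk
  simpa using (Finset.mem_filter.1 hk).2

lemma tendsto_hits_atTop {P : ℕ → Prop} (h : {k | P k}.Infinite) :
    Filter.Tendsto (hits P) Filter.atTop Filter.atTop := by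
  classical
  refine Filter.tendsto_atTop_atTop_of_monotone (hits_monotone P) fun b => ⟨Nat.nth P b, ?_⟩
  rw [hits]
  exact (Nat.count_nth_of_infinite h b).ge

/-- A position `n` satisfying `P` is the term of index `hits P n` in the enumeration of `P`. This
converts counts along positions into counts along the extracted subsequence. -/
lemma hits_and (P B : ℕ → Prop) (n : ℕ) :
    hits (fun k => P k ∧ B k) n = hits (fun k => B (Nat.nth P k)) (hits P n) := by
  classical
  induction n with
  | zero => simp [hits]
  | succ n ih =>
    rw [hits_succ, hits_succ, ih]
    by_cases hP : P n
    · have : Nat.nth P (hits P n) = n := by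
        rw [hits]; exact Nat.nth_count hP
      simp [hP, hits_succ, this]
    · simp [hP]

lemma hits_nth {P : ℕ → Prop} (h : {k | P k}.Infinite) (n : ℕ) : hits P (Nat.nth P n) = n := by
  classical
  rw [hits]; exact Nat.count_nth_of_infinite h n

/-! ### Occurrences of words, indexed by their right end. -/

variable {A : Type*}

/-- The first `k` letters of `Y`, in reverse order. -/
def revPrefix (Y : ℕ → A) : ℕ → List A
  | 0 => []
  | k + 1 => Y k :: revPrefix Y k

lemma length_revPrefix (Y : ℕ → A) (k : ℕ) : (revPrefix Y k).length = k := by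
  induction k with
  | zero => rfl
  | succ k ih => simp [revPrefix, ih]

lemma revPrefix_eq_reverse (Y : ℕ → A) (k : ℕ) :
    revPrefix Y k = ((List.range k).map Y).reverse := by
  induction k with
  | zero => rfl
  | succ k ih => simp [revPrefix, ih, List.range_succ]

/-- The word `v.reverse` ends in `Y` just before position `k`. -/
def Ends (Y : ℕ → A) (v : List A) (k : ℕ) : Prop := v <+: revPrefix Y k

lemma ends_nil (Y : ℕ → A) (k : ℕ) : Ends Y [] k := List.nil_prefix

/-- Words are stored reversed so that adding the next letter in time is a `cons`; inductions on `v`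
then follow the reading order. -/
lemma ends_cons_succ (Y : ℕ → A) (a : A) (v : List A) (k : ℕ) :
    Ends Y (a :: v) (k + 1) ↔ Ends Y v k ∧ Y k = a := by
  simp only [Ends, revPrefix, List.cons_prefix_cons]
  tauto

lemma not_ends_cons_zero (Y : ℕ → A) (a : A) (v : List A) : ¬ Ends Y (a :: v) 0 := by
  simp [Ends, revPrefix]

lemma Ends.length_le {Y : ℕ → A} {v : List A} {k : ℕ} (h : Ends Y v k) : v.length ≤ k := by
  simpa [length_revPrefix] using List.IsPrefix.length_le h

lemma hits_ends_cons (Y : ℕ → A) (a : A) (v : List A) (n : ℕ) :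
    hits (Ends Y (a :: v)) (n + 1) = hits (fun k => Ends Y v k ∧ Y k = a) n := by
  classical
  induction n with
  | zero => rw [hits_succ, hits_zero, hits_zero, if_neg (not_ends_cons_zero Y a v)]
  | succ n ih =>
    rw [hits_succ, ih, hits_succ]
    simp [ends_cons_succ]

lemma ends_add_length_iff (Y : ℕ → A) (u : List A) {n i : ℕ} (h : i + u.length ≤ n + 1) :
    Ends Y u.reverse (i + u.length) ↔ ((initialWord Y n).drop i).take u.length = u := by
  have h1 : (List.range (i + u.length)).map Y = (initialWord Y n).take (i + u.length) := by
    rw [initialWord, ← List.map_take, List.take_range, min_eq_left h]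
  rw [Ends, revPrefix_eq_reverse, List.reverse_prefix, h1, List.suffix_iff_eq_drop, List.drop_take]
  have h2 : ((initialWord Y n).take (i + u.length)).length - u.length = i := by
    simp [initialWord]; omega
  rw [h2, Nat.add_sub_cancel_left, eq_comm]

lemma nbocc_initialWord (Y : ℕ → A) (u : List A) (n : ℕ) :
    nbocc u (initialWord Y n) = hits (Ends Y u.reverse) (n + 2) := by
  classical
  have hl : (initialWord Y n).length = n + 1 := by simp [initialWord]
  rw [nbocc, hits, Nat.count_eq_card_filter_range]
  refine Finset.card_bij (fun i _ => i + u.length) ?_ ?_ ?_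
  · intro i hi
    obtain ⟨-, h1, h2⟩ := Finset.mem_filter.1 hi
    rw [hl] at h1
    refine Finset.mem_filter.2 ⟨Finset.mem_range.2 (by omega), ?_⟩
    exact (ends_add_length_iff Y u h1).2 h2
  · intro i _ j _ h
    simpa using h
  · intro k hk
    obtain ⟨h1, h2⟩ := Finset.mem_filter.1 hk
    have h3 := h2.length_le
    rw [List.length_reverse] at h3
    have h4 : k - u.length + u.length = k := by omega
    have h5 := Finset.mem_range.1 h1
    have h6 : k - u.length + u.length ≤ n + 1 := by omega
    refine ⟨k - u.length, Finset.mem_filter.2 ⟨?_, ?_, ?_⟩, h4⟩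
    · rw [hl]; exact Finset.mem_range.2 (by omega)
    · rw [hl]; omega
    · rw [← ends_add_length_iff Y u h6, h4]; exact h2

/-! ### Normality through conditional letter frequencies. -/

open Filter Topology MeasureTheory ProbabilityTheory

lemma tendsto_natCast_sub_div (c : ℝ) : Tendsto (fun m : ℕ => ((m : ℝ) - c) / m) atTop (𝓝 1) := by
  have h : Tendsto (fun m : ℕ => 1 - c / (m : ℝ)) atTop (𝓝 (1 - 0)) :=
    tendsto_const_nhds.sub (tendsto_const_div_atTop_nhds_zero_nat c)
  rw [sub_zero] at h
  refine h.congr' ?_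
  filter_upwards [eventually_gt_atTop 0] with m hm
  have : (m : ℝ) ≠ 0 := by positivity
  field_simp

lemma tendsto_div_natCast_sub_iff (f : ℕ → ℝ) (c l : ℝ) :
    Tendsto (fun m : ℕ => f m / ((m : ℝ) - c)) atTop (𝓝 l) ↔
      Tendsto (fun m : ℕ => f m / (m : ℝ)) atTop (𝓝 l) := by
  have hc := tendsto_natCast_sub_div c
  have hev : ∀ᶠ m : ℕ in atTop, (m : ℝ) - c ≠ 0 ∧ (m : ℝ) ≠ 0 := by
    filter_upwards [eventually_gt_atTop 0, tendsto_natCast_atTop_atTop.eventually_gt_atTop c]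
      with m hm hmc
    exact ⟨by linarith, by positivity⟩
  constructor
  · intro h
    have := h.mul hc
    rw [mul_one] at this
    refine this.congr' ?_
    filter_upwards [hev] with m hm
    obtain ⟨h1, h2⟩ := hm
    field_simp
  · intro h
    have := h.div hc one_ne_zero
    rw [div_one] at this
    refine this.congr' ?_
    filter_upwards [hev] with m hm
    obtain ⟨h1, h2⟩ := hm
    simp only [Pi.div_apply]
    field_simp

lemma hasFreq_iff (Y : ℕ → A) (u : List A) (f : ℝ) :
    HasFreq u Y f ↔
      Tendsto (fun m : ℕ => (hits (Ends Y u.reverse) m : ℝ) / m) atTop (𝓝 f) := by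
  -- The word `X(0) ⋯ X(n)` has the `n + 2` possible right ends `0, …, n + 1`, so with `m = n + 2`
  -- the denominator of `freq` is `m - |u|`.
  rw [← tendsto_div_natCast_sub_iff _ (u.length : ℝ), ← tendsto_add_atTop_iff_nat 2, HasFreq]
  refine iff_of_eq (congrArg (fun F => Tendsto F atTop (𝓝 f)) (funext fun n => ?_))
  rw [freq, nbocc_initialWord]
  congr 1
  simp [initialWord]
  ring

lemma wordWeight_reverse (μ : A → ℝ) (v : List A) : wordWeight μ v.reverse = wordWeight μ v := by
  rw [wordWeight, wordWeight, List.map_reverse]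
  exact (List.reverse_perm _).prod_eq

lemma wordWeight_pos {μ : A → ℝ} (hμ : ∀ a, 0 < μ a) (v : List A) : 0 < wordWeight μ v := by
  induction v with
  | nil => simp [wordWeight]
  | cons a v ih =>
    have : wordWeight μ (a :: v) = μ a * wordWeight μ v := by simp [wordWeight]
    rw [this]; exact mul_pos (hμ a) ih

lemma wordWeight_cons (μ : A → ℝ) (a : A) (v : List A) :
    wordWeight μ (a :: v) = μ a * wordWeight μ v := by
  simp [wordWeight]

lemma isNormal_iff (μ : A → ℝ) (Y : ℕ → A) :
    IsNormal μ Y ↔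
      ∀ v, Tendsto (fun m : ℕ => (hits (Ends Y v) m : ℝ) / m) atTop (𝓝 (wordWeight μ v)) := by
  constructor
  · intro h v
    have := (hasFreq_iff Y _ _).1 (h v.reverse)
    rwa [List.reverse_reverse, wordWeight_reverse] at this
  · intro h w
    rw [hasFreq_iff, ← wordWeight_reverse]
    exact h _

lemma tendsto_hits_ends_cons_iff (Y : ℕ → A) (a : A) (v : List A) (l : ℝ) :
    Tendsto (fun m : ℕ => (hits (Ends Y (a :: v)) m : ℝ) / m) atTop (𝓝 l) ↔
      Tendsto (fun m : ℕ => (hits (fun k => Ends Y v k ∧ Y k = a) m : ℝ) / m) atTop (𝓝 l) := by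
  rw [← tendsto_div_natCast_sub_iff _ 1, ← tendsto_add_atTop_iff_nat 1]
  simp only [hits_ends_cons]
  simp

lemma isBalanced_iff (μ : A → ℝ) (Y : ℕ → A) :
    IsBalanced μ Y ↔
      ∀ a, Tendsto (fun m : ℕ => (hits (fun k => Y k = a) m : ℝ) / m) atTop (𝓝 (μ a)) := by
  refine forall_congr' fun a => ?_
  rw [hasFreq_iff, List.reverse_singleton, tendsto_hits_ends_cons_iff]
  simp [ends_nil]

lemma IsNormal.isBalanced {μ : A → ℝ} {Y : ℕ → A} (h : IsNormal μ Y) : IsBalanced μ Y := by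
  intro a
  simpa [wordWeight] using h [a]

/-- The frequency of `v` followed by `a` is the frequency of `v` times the conditional frequency of
`a` after `v`. -/
lemma isNormal_of_ratio {μ : A → ℝ} (hμ : ∀ a, 0 < μ a) {Y : ℕ → A}
    (h : ∀ v a, {k | Ends Y v k}.Infinite →
      Tendsto (fun m : ℕ => (hits (fun k => Ends Y v k ∧ Y k = a) m : ℝ) / hits (Ends Y v) m)
        atTop (𝓝 (μ a))) : IsNormal μ Y := by
  rw [isNormal_iff]
  intro v
  induction v with
  | nil =>
    have h1 : ∀ m, hits (Ends Y []) m = m := by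
      intro m
      induction m with
      | zero => simp [hits]
      | succ m ih => rw [hits_succ, ih, if_pos (ends_nil Y m)]
    simp only [h1, wordWeight, List.map_nil, List.prod_nil]
    refine tendsto_const_nhds.congr' ?_
    filter_upwards [eventually_gt_atTop 0] with m hm
    rw [div_self (by positivity)]
  | cons a v ih =>
    rw [tendsto_hits_ends_cons_iff, wordWeight_cons]
    -- By induction `v` has the frequency `wordWeight μ v`, which is positive; finitely many
    -- occurrences would give frequency zero.
    have hinf : {k | Ends Y v k}.Infinite := by
      intro hfin
      have h0 : Tendsto (fun m : ℕ => (hits (Ends Y v) m : ℝ) / m) atTop (𝓝 0) := by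
        refine squeeze_zero (fun m => by positivity) (fun m => ?_)
          (tendsto_const_div_atTop_nhds_zero_nat (hfin.toFinset.card : ℝ))
        have := hits_le_card_of_finite hfin m
        gcongr
      exact (wordWeight_pos hμ v).ne' (tendsto_nhds_unique ih h0)
    refine ((h v a hinf).mul ih).congr fun m => ?_
    have hle := hits_mono_pred (P := fun k => Ends Y v k ∧ Y k = a) (P' := Ends Y v)
      (fun k hk => hk.1) m
    by_cases h0 : hits (Ends Y v) m = 0
    · have : hits (fun k => Ends Y v k ∧ Y k = a) m = 0 := by omega
      simp [h0, this]
    · have : (hits (Ends Y v) m : ℝ) ≠ 0 := by exact_mod_cast h0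
      field_simp

/-- A ratio along a subset of positions is a frequency in the extracted subsequence. -/
lemma tendsto_ratio_of_tendsto_nth {P B : ℕ → Prop} (hP : {k | P k}.Infinite) {l : ℝ}
    (h : Tendsto (fun m : ℕ => (hits (fun k => B (Nat.nth P k)) m : ℝ) / m) atTop (𝓝 l)) :
    Tendsto (fun n : ℕ => (hits (fun k => P k ∧ B k) n : ℝ) / hits P n) atTop (𝓝 l) := by
  refine (h.comp (tendsto_hits_atTop hP)).congr fun n => ?_
  simp [hits_and]

/-! ### A strong law of large numbers for bounded orthogonal variables. -/

section StrongLaw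

variable {Ω : Type*} [MeasurableSpace Ω] {ν : Measure Ω} [IsProbabilityMeasure ν]

lemma integrable_of_measurable_of_bounded {f : Ω → ℝ} (hf : Measurable f) {C : ℝ}
    (hC : ∀ ω, |f ω| ≤ C) : Integrable f ν :=
  Integrable.of_bound hf.aestronglyMeasurable C (Eventually.of_forall hC)

lemma abs_sum_range_le {x : ℕ → ℝ} {C : ℝ} (hC : ∀ n, |x n| ≤ C) (n : ℕ) :
    |∑ i ∈ Finset.range n, x i| ≤ n * C := by
  refine (Finset.abs_sum_le_sum_abs _ _).trans ?_
  refine (Finset.sum_le_sum fun i _ => hC i).trans ?_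
  simp

lemma integral_sq_sum_le {ξ : ℕ → Ω → ℝ} (hm : ∀ n, Measurable (ξ n)) {C : ℝ}
    (hC : ∀ n ω, |ξ n ω| ≤ C) (horth : ∀ m n, m < n → ∫ ω, ξ m ω * ξ n ω ∂ν = 0) (M : ℕ) :
    ∫ ω, (∑ n ∈ Finset.range M, ξ n ω) ^ 2 ∂ν ≤ M * C ^ 2 := by
  have hmS : ∀ M, Measurable fun ω => ∑ n ∈ Finset.range M, ξ n ω := fun M =>
    Finset.measurable_sum _ fun n _ => hm n
  have hξξ : ∀ m n, Integrable (fun ω => ξ m ω * ξ n ω) ν := fun m n =>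
    integrable_of_measurable_of_bounded ((hm m).mul (hm n)) (C := C * C) fun ω => by
      rw [abs_mul]
      exact mul_le_mul (hC m ω) (hC n ω) (abs_nonneg _) ((abs_nonneg _).trans (hC m ω))
  have hSS : ∀ M, Integrable (fun ω => (∑ n ∈ Finset.range M, ξ n ω) ^ 2) ν := fun M =>
    integrable_of_measurable_of_bounded ((hmS M).pow_const 2) (C := (M * C) ^ 2) fun ω => by
      rw [abs_pow]
      exact pow_le_pow_left₀ (abs_nonneg _) (abs_sum_range_le (fun n => hC n ω) M) 2
  induction M with
  | zero => simp
  | succ M ih =>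
    have hcross : ∫ ω, (∑ n ∈ Finset.range M, ξ n ω) * ξ M ω ∂ν = 0 := by
      simp_rw [Finset.sum_mul]
      rw [integral_finsetSum _ fun i _ => hξξ i M]
      exact Finset.sum_eq_zero fun i hi => horth i M (Finset.mem_range.1 hi)
    have hcrossI : Integrable (fun ω => (∑ n ∈ Finset.range M, ξ n ω) * ξ M ω) ν := by
      simp_rw [Finset.sum_mul]
      exact integrable_finsetSum _ fun i _ => hξξ i M
    have hlast : ∫ ω, ξ M ω * ξ M ω ∂ν ≤ C ^ 2 := by
      have h := integral_mono (hξξ M M) (integrable_const (C ^ 2)) (μ := ν) fun ω => by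
        change ξ M ω * ξ M ω ≤ C ^ 2
        rw [← sq, ← sq_abs]
        exact pow_le_pow_left₀ (abs_nonneg _) (hC M ω) 2
      simpa using h
    have hexp : ∀ ω, (∑ n ∈ Finset.range (M + 1), ξ n ω) ^ 2 =
        (∑ n ∈ Finset.range M, ξ n ω) ^ 2 +
          2 * ((∑ n ∈ Finset.range M, ξ n ω) * ξ M ω) + ξ M ω * ξ M ω := fun ω => by
      rw [Finset.sum_range_succ]; ring
    simp_rw [hexp]
    have hA : Integrable (fun ω => (∑ n ∈ Finset.range M, ξ n ω) ^ 2 +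
        2 * ((∑ n ∈ Finset.range M, ξ n ω) * ξ M ω)) ν := (hSS M).add (hcrossI.const_mul 2)
    rw [integral_add hA (hξξ M M),
      integral_add (hSS M) (hcrossI.const_mul 2), integral_const_mul, hcross]
    push_cast
    linarith

/-- Between `k ^ 2` and the next square there are at most `2 * k` further terms, each bounded by
`C`, which change the average by at most `2 * C / k`. -/
lemma tendsto_average_of_tendsto_squares {x : ℕ → ℝ} {C : ℝ} (hC : ∀ n, |x n| ≤ C)
    (h : Tendsto (fun k : ℕ => ((∑ i ∈ Finset.range (k ^ 2), x i) / (k : ℝ) ^ 2) ^ 2)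
      atTop (𝓝 0)) :
    Tendsto (fun n : ℕ => (∑ i ∈ Finset.range n, x i) / (n : ℝ)) atTop (𝓝 0) := by
  have hC0 : 0 ≤ C := (abs_nonneg _).trans (hC 0)
  have h1 : Tendsto (fun k : ℕ => |(∑ i ∈ Finset.range (k ^ 2), x i) / (k : ℝ) ^ 2| + 2 * C / k)
      atTop (𝓝 0) := by
    have h2 := h.sqrt
    simp_rw [Real.sqrt_sq_eq_abs, Real.sqrt_zero] at h2
    simpa using h2.add (tendsto_const_div_atTop_nhds_zero_nat (2 * C))
  have hsqrt : Tendsto Nat.sqrt atTop atTop := by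
    refine tendsto_atTop_atTop_of_monotone (fun a b hab => Nat.sqrt_le_sqrt hab) fun b =>
      ⟨b * b, ?_⟩
    rw [Nat.sqrt_eq]
  refine squeeze_zero_norm' ?_ (h1.comp hsqrt)
  filter_upwards [hsqrt.eventually_gt_atTop 0] with n hn
  rw [Real.norm_eq_abs]
  simp only [Function.comp]
  set k := Nat.sqrt n with hk
  have hk1 : k ^ 2 ≤ n := Nat.sqrt_le' n
  have hk2 : n ≤ k ^ 2 + 2 * k := by
    have := Nat.sqrt_le_add n
    rw [← hk] at this
    nlinarith
  clear_value k
  obtain ⟨d, rfl⟩ := Nat.exists_eq_add_of_le hk1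
  have hd : (d : ℝ) ≤ 2 * k := by exact_mod_cast (by omega : d ≤ 2 * k)
  have hsum : |∑ i ∈ Finset.range (k ^ 2 + d), x i| ≤
      |∑ i ∈ Finset.range (k ^ 2), x i| + 2 * k * C := by
    rw [Finset.sum_range_add]
    refine (abs_add_le _ _).trans ?_
    have := abs_sum_range_le (x := fun i => x (k ^ 2 + i)) (fun i => hC _) d
    nlinarith
  have hkpos : (0 : ℝ) < k := by exact_mod_cast hn
  rw [abs_div, abs_div, abs_of_nonneg (by positivity : (0 : ℝ) ≤ ((k ^ 2 + d : ℕ) : ℝ)),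
    abs_of_nonneg (by positivity : (0 : ℝ) ≤ (k : ℝ) ^ 2)]
  calc |∑ i ∈ Finset.range (k ^ 2 + d), x i| / ((k ^ 2 + d : ℕ) : ℝ)
      ≤ (|∑ i ∈ Finset.range (k ^ 2), x i| + 2 * k * C) / (k : ℝ) ^ 2 := by
        push_cast
        gcongr
        linarith [(Nat.cast_nonneg d : (0 : ℝ) ≤ d)]
    _ = _ := by field_simp

/-- The strong law of large numbers for bounded, pairwise orthogonal random variables. -/
theorem ae_tendsto_average_zero {ξ : ℕ → Ω → ℝ} (hm : ∀ n, Measurable (ξ n)) {C : ℝ}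
    (hC : ∀ n ω, |ξ n ω| ≤ C) (horth : ∀ m n, m < n → ∫ ω, ξ m ω * ξ n ω ∂ν = 0) :
    ∀ᵐ ω ∂ν, Tendsto (fun n : ℕ => (∑ i ∈ Finset.range n, ξ i ω) / (n : ℝ)) atTop (𝓝 0) := by
  -- Along the squares the averages have second moment at most `C ^ 2 / k ^ 2`. This is summable, so
  -- almost surely the sum of the `Y k` is finite and its terms tend to zero.
  set Y : ℕ → Ω → ℝ := fun k ω => ((∑ i ∈ Finset.range (k ^ 2), ξ i ω) / (k : ℝ) ^ 2) ^ 2 with hY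
  have hYm : ∀ k, Measurable (Y k) := fun k =>
    ((Finset.measurable_sum _ fun n _ => hm n).div_const _).pow_const 2
  have hYint : ∀ k, Integrable (Y k) ν := fun k =>
    integrable_of_measurable_of_bounded (hYm k) (C := (((k ^ 2 : ℕ) * C) / (k : ℝ) ^ 2) ^ 2)
      fun ω => by
        simp only [hY]
        rw [abs_pow, abs_div, abs_of_nonneg (by positivity : (0 : ℝ) ≤ (k : ℝ) ^ 2)]
        have := abs_sum_range_le (fun n => hC n ω) (k ^ 2)
        gcongr
  have hYle : ∀ k, ∫ ω, Y k ω ∂ν ≤ C ^ 2 * (1 / (k : ℝ) ^ 2) := fun k => by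
    simp only [hY, div_pow]
    rw [integral_div]
    have := integral_sq_sum_le (ν := ν) hm hC horth (k ^ 2)
    rcases Nat.eq_zero_or_pos k with rfl | hk
    · simp
    · have hk' : (0 : ℝ) < k := by exact_mod_cast hk
      rw [div_le_iff₀ (by positivity)]
      refine this.trans (le_of_eq ?_)
      push_cast
      field_simp
  have hsum : ∑' k, ∫⁻ ω, ENNReal.ofReal (Y k ω) ∂ν ≠ ⊤ := by
    have hs : Summable fun k : ℕ => C ^ 2 * (1 / (k : ℝ) ^ 2) :=
      (Real.summable_one_div_nat_pow.2 one_lt_two).mul_left _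
    have hle : ∀ k, ∫⁻ ω, ENNReal.ofReal (Y k ω) ∂ν ≤
        ENNReal.ofReal (C ^ 2 * (1 / (k : ℝ) ^ 2)) := fun k => by
      rw [← ofReal_integral_eq_lintegral_ofReal (hYint k)
        (Eventually.of_forall fun ω => sq_nonneg _)]
      exact ENNReal.ofReal_le_ofReal (hYle k)
    exact ne_top_of_le_ne_top hs.tsum_ofReal_ne_top (ENNReal.tsum_le_tsum hle)
  rw [← lintegral_tsum fun k => (hYm k).ennreal_ofReal.aemeasurable] at hsum
  filter_upwards [ae_lt_top (Measurable.tsum fun k => (hYm k).ennreal_ofReal) hsum] with ω hω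
  refine tendsto_average_of_tendsto_squares (fun n => hC n ω) ?_
  have h := (ENNReal.tendsto_toReal ENNReal.zero_ne_top).comp
    (ENNReal.tendsto_atTop_zero_of_tsum_ne_top hω.ne)
  simp only [ENNReal.toReal_zero] at h
  refine h.congr fun k => ?_
  exact ENNReal.toReal_ofReal (sq_nonneg _)

end StrongLaw

/-! ### Cesàro averages and shifts. -/

section Averages

/-- The average of the first `n` terms of a sequence. -/
noncomputable def avg (x : ℕ → ℝ) (n : ℕ) : ℝ := (∑ i ∈ Finset.range n, x i) / n

lemma avg_zero : avg (fun _ => 0) = fun _ => 0 := by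
  funext n
  simp [avg]

lemma avg_add (x y : ℕ → ℝ) (n : ℕ) : avg (fun i => x i + y i) n = avg x n + avg y n := by
  simp only [avg, Finset.sum_add_distrib, add_div]

lemma avg_sub (x y : ℕ → ℝ) (n : ℕ) : avg (fun i => x i - y i) n = avg x n - avg y n := by
  simp only [avg, Finset.sum_sub_distrib, sub_div]

lemma avg_mul_const (x : ℕ → ℝ) (c : ℝ) (n : ℕ) : avg (fun i => x i * c) n = avg x n * c := by
  simp only [avg, ← Finset.sum_mul]
  ring

lemma avg_sum {ι : Type*} (s : Finset ι) (x : ι → ℕ → ℝ) (n : ℕ) :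
    avg (fun i => ∑ j ∈ s, x j i) n = ∑ j ∈ s, avg (x j) n := by
  simp only [avg]
  rw [Finset.sum_comm, Finset.sum_div]

lemma avg_mono {x y : ℕ → ℝ} (h : ∀ i, x i ≤ y i) (n : ℕ) : avg x n ≤ avg y n :=
  div_le_div_of_nonneg_right (Finset.sum_le_sum fun i _ => h i) (Nat.cast_nonneg n)

lemma abs_avg_le (x : ℕ → ℝ) (n : ℕ) : |avg x n| ≤ avg (fun i => |x i|) n := by
  rw [avg, abs_div, Nat.abs_cast]
  exact div_le_div_of_nonneg_right (Finset.abs_sum_le_sum_abs _ _) (Nat.cast_nonneg n)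

/-- A shift by one telescopes, leaving two bounded boundary terms divided by `n`. -/
lemma tendsto_avg_shift_sub {x : ℕ → ℝ} {C : ℝ} (hC : ∀ n, |x n| ≤ C) (j : ℕ) :
    Tendsto (avg fun n => x (n + j) - x n) atTop (𝓝 0) := by
  induction j with
  | zero =>
    simp only [add_zero, sub_self, avg_zero]
    exact tendsto_const_nhds
  | succ j ih =>
    have h1 : Tendsto (avg fun n => x (n + 1 + j) - x (n + j)) atTop (𝓝 0) := by
      refine squeeze_zero_norm (fun n => ?_) (tendsto_const_div_atTop_nhds_zero_nat (2 * C))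
      rw [avg, Finset.sum_range_sub (fun n => x (n + j)), norm_div, Real.norm_natCast,
        Real.norm_eq_abs]
      gcongr
      have h2 := hC (n + j)
      have h3 := hC (0 + j)
      exact (abs_sub _ _).trans (by linarith)
    have h2 := h1.add ih
    rw [add_zero] at h2
    refine h2.congr fun n => ?_
    rw [← avg_add]
    congr 1
    funext i
    rw [add_right_comm, add_assoc]
    ring

lemma tendsto_avg_sum_shift_sub {x : ℕ → ℝ} {C : ℝ} (hC : ∀ n, |x n| ≤ C) (l : ℕ) :
    Tendsto (avg fun n => ∑ j ∈ Finset.range l, x (n + j) - l * x n) atTop (𝓝 0) := by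
  have h := tendsto_finsetSum (Finset.range l) fun j _ => tendsto_avg_shift_sub hC j
  simp only [Finset.sum_const_zero] at h
  refine h.congr fun n => ?_
  rw [← avg_sum]
  congr 1
  funext i
  simp

open Classical in
lemma hits_div_eq_avg (P : ℕ → Prop) (n : ℕ) :
    (hits P n : ℝ) / n = avg (fun i => if P i then 1 else 0) n := by
  rw [hits_eq_sum, avg]

end Averages

/-! ### Window averages along a normal sequence. -/

section Windows

variable {A : Type*}

/-- The word `X(n) ⋯ X(n+l-1)`, in reverse order. -/
def revWindow (X : ℕ → A) (n : ℕ) : ℕ → List A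
  | 0 => []
  | l + 1 => X (n + l) :: revWindow X n l

lemma length_revWindow (X : ℕ → A) (n l : ℕ) : (revWindow X n l).length = l := by
  induction l with
  | zero => rfl
  | succ l ih => simp [revWindow, ih]

lemma revWindow_eq_iff (X : ℕ → A) (n : ℕ) (v : List A) :
    revWindow X n v.length = v ↔ Ends X v (n + v.length) := by
  induction v with
  | nil => simp [revWindow, ends_nil]
  | cons b v ih =>
    rw [List.length_cons, ← add_assoc, ends_cons_succ, ← ih, revWindow, List.cons.injEq]
    tauto

lemma revWindow_suffix (X : ℕ → A) (n : ℕ) {j l : ℕ} (h : j ≤ l) :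
    revWindow X n j <:+ revWindow X n l := by
  induction l, h using Nat.le_induction with
  | base => exact List.suffix_rfl
  | succ l _ ih => exact ih.trans (List.suffix_cons _ _)

open Classical in
lemma IsNormal.tendsto_avg_window_eq {μ : A → ℝ} {X : ℕ → A} (hX : IsNormal μ X) (v : List A) :
    Tendsto (avg fun n => if revWindow X n v.length = v then 1 else 0) atTop
      (𝓝 (wordWeight μ v)) := by
  have h1 := (isNormal_iff μ X).1 hX v
  simp_rw [hits_div_eq_avg] at h1
  have h2 := tendsto_avg_shift_sub (x := fun i => if Ends X v i then (1 : ℝ) else 0) (C := 1)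
    (fun n => by split_ifs <;> simp) v.length
  have h3 := h2.add h1
  rw [zero_add] at h3
  refine h3.congr fun n => ?_
  rw [← avg_add]
  congr 1
  funext i
  simp [revWindow_eq_iff]

variable [Fintype A]

lemma sum_words_succ (l : ℕ) (g : List A → ℝ) :
    ∑ f : Fin (l + 1) → A, g (List.ofFn f) = ∑ b, ∑ f : Fin l → A, g (b :: List.ofFn f) := by
  rw [← (Fin.consEquiv fun _ : Fin (l + 1) => A).sum_comp, Fintype.sum_prod_type]
  simp [Fin.consEquiv, List.ofFn_succ]

open Classical in
lemma sum_words_ite (w : List A) (Φ : List A → ℝ) :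
    ∑ f : Fin w.length → A, (if w = List.ofFn f then 1 else 0) * Φ (List.ofFn f) = Φ w := by
  induction w generalizing Φ with
  | nil => simp
  | cons b w ih =>
    have h := sum_words_succ w.length fun v => (if b :: w = v then (1 : ℝ) else 0) * Φ v
    rw [List.length_cons, h, Finset.sum_eq_single b]
    · simp only [List.cons.injEq, true_and]
      exact ih fun v => Φ (b :: v)
    · intro b' _ hb'
      refine Finset.sum_eq_zero fun f _ => ?_
      rw [if_neg, zero_mul]
      rintro h
      exact hb' (List.cons.inj h).1.symm
    · simp

/-- The expectation of `Φ` at a random word of length `l` with independent `μ`-distributed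
letters. -/
noncomputable def wordMean (μ : A → ℝ) (l : ℕ) (Φ : List A → ℝ) : ℝ :=
  ∑ f : Fin l → A, wordWeight μ (List.ofFn f) * Φ (List.ofFn f)

lemma wordMean_zero (μ : A → ℝ) (Φ : List A → ℝ) : wordMean μ 0 Φ = Φ [] := by
  simp [wordMean, wordWeight]

lemma wordMean_succ (μ : A → ℝ) (l : ℕ) (Φ : List A → ℝ) :
    wordMean μ (l + 1) Φ = wordMean μ l fun v => ∑ b, μ b * Φ (b :: v) := by
  rw [wordMean, sum_words_succ l fun v => wordWeight μ v * Φ v, Finset.sum_comm, wordMean]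
  refine Finset.sum_congr rfl fun f _ => ?_
  rw [Finset.mul_sum]
  refine Finset.sum_congr rfl fun b _ => ?_
  rw [wordWeight_cons]
  ring

lemma wordMean_mono {μ : A → ℝ} (hμ : ∀ a, 0 < μ a) (l : ℕ) {Φ Ψ : List A → ℝ}
    (h : ∀ v, Φ v ≤ Ψ v) : wordMean μ l Φ ≤ wordMean μ l Ψ :=
  Finset.sum_le_sum fun _ _ => mul_le_mul_of_nonneg_left (h _) (wordWeight_pos hμ _).le

lemma wordMean_add (μ : A → ℝ) (l : ℕ) (Φ Ψ : List A → ℝ) :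
    wordMean μ l (fun v => Φ v + Ψ v) = wordMean μ l Φ + wordMean μ l Ψ := by
  simp only [wordMean, mul_add, Finset.sum_add_distrib]

lemma wordMean_mul_const (μ : A → ℝ) (l : ℕ) (Φ : List A → ℝ) (c : ℝ) :
    wordMean μ l (fun v => Φ v * c) = wordMean μ l Φ * c := by
  simp only [wordMean, ← mul_assoc, ← Finset.sum_mul]

lemma wordMean_const {μ : A → ℝ} (hμ : ∑ a, μ a = 1) (l : ℕ) (c : ℝ) :
    wordMean μ l (fun _ => c) = c := by
  induction l with
  | zero => rw [wordMean_zero]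
  | succ l ih => rw [wordMean_succ, ← Finset.sum_mul, hμ, one_mul, ih]

lemma wordMean_sum {ι : Type*} (s : Finset ι) (μ : A → ℝ) (l : ℕ) (Φ : ι → List A → ℝ) :
    wordMean μ l (fun v => ∑ i ∈ s, Φ i v) = ∑ i ∈ s, wordMean μ l (Φ i) := by
  simp only [wordMean, Finset.mul_sum]
  rw [Finset.sum_comm]

/-- Along a normal sequence, the averages of a function of a window converge. -/
lemma IsNormal.tendsto_avg_window {μ : A → ℝ} {X : ℕ → A} (hX : IsNormal μ X) (l : ℕ)
    (Φ : List A → ℝ) :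
    Tendsto (avg fun n => Φ (revWindow X n l)) atTop (𝓝 (wordMean μ l Φ)) := by
  classical
  have h : Tendsto (fun M => ∑ f : Fin l → A,
      avg (fun n => if revWindow X n l = List.ofFn f then 1 else 0) M * Φ (List.ofFn f))
      atTop (𝓝 (wordMean μ l Φ)) := by
    refine tendsto_finsetSum _ fun f _ => Tendsto.mul_const _ ?_
    have := hX.tendsto_avg_window_eq (List.ofFn f)
    rwa [List.length_ofFn] at this
  refine h.congr fun M => ?_
  simp_rw [← avg_mul_const]
  rw [← avg_sum]
  congr 1
  funext n
  have := sum_words_ite (revWindow X n l) Φ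
  rwa [length_revWindow] at this

end Windows

/-! ### Finite chains driven by words: reachability and discrepancy. -/

section Chains

variable {A R : Type*} [Fintype R]

/-- The distribution of the state reached from `s` by reading the word `v.reverse`, under the
transition probabilities `t`. -/
noncomputable def stateDist (t : R → A → R → ℝ) (s : R) : List A → R → ℝ
  | [] => open Classical in fun r => if s = r then 1 else 0
  | b :: v => fun r' => ∑ r, stateDist t s v r * t r b r'

/-- `t` consists of transition probabilities. -/
structure IsStochastic (t : R → A → R → ℝ) : Prop where
  nonneg : ∀ r a r', 0 ≤ t r a r'
  sum_eq_one : ∀ r a, ∑ r', t r a r' = 1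

lemma stateDist_nonneg {t : R → A → R → ℝ} (ht : IsStochastic t) (s : R) (v : List A) (r : R) :
    0 ≤ stateDist t s v r := by
  induction v generalizing r with
  | nil => simp only [stateDist]; split_ifs <;> norm_num
  | cons b v ih => exact Finset.sum_nonneg fun r' _ => mul_nonneg (ih r') (ht.nonneg _ _ _)

lemma sum_stateDist {t : R → A → R → ℝ} (ht : IsStochastic t) (s : R) (v : List A) :
    ∑ r, stateDist t s v r = 1 := by
  classical
  induction v with
  | nil => simp [stateDist]
  | cons b v ih =>
    simp only [stateDist]
    rw [Finset.sum_comm]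
    simp_rw [← Finset.mul_sum, ht.sum_eq_one, mul_one]
    exact ih

lemma stateDist_cons_pairing (t : R → A → R → ℝ) (s : R) (b : A) (v : List A) (h : R → ℝ) :
    ∑ r', stateDist t s (b :: v) r' * h r' =
      ∑ r, stateDist t s v r * ∑ r', t r b r' * h r' := by
  simp only [stateDist, Finset.sum_mul, Finset.mul_sum]
  rw [Finset.sum_comm]
  simp only [mul_assoc]

lemma stateDist_nil_pairing (t : R → A → R → ℝ) (s : R) (h : R → ℝ) :
    ∑ r, stateDist t s [] r * h r = h s := by
  classical
  simp [stateDist]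

lemma stateDist_append (t : R → A → R → ℝ) (s : R) (v v' : List A) (r' : R) :
    stateDist t s (v' ++ v) r' = ∑ r, stateDist t s v r * stateDist t r v' r' := by
  classical
  induction v' generalizing r' with
  | nil => simp [stateDist]
  | cons b v' ih =>
    simp only [List.cons_append, stateDist, ih, Finset.sum_mul, Finset.mul_sum]
    rw [Finset.sum_comm]
    simp only [mul_assoc]

lemma mul_le_stateDist_append {t : R → A → R → ℝ} (ht : IsStochastic t) (s : R) (v v' : List A)
    (r r' : R) : stateDist t s v r * stateDist t r v' r' ≤ stateDist t s (v' ++ v) r' := by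
  rw [stateDist_append]
  exact Finset.single_le_sum (f := fun r => stateDist t s v r * stateDist t r v' r')
    (fun i _ => mul_nonneg (stateDist_nonneg ht _ _ _) (stateDist_nonneg ht _ _ _))
    (Finset.mem_univ r)

lemma stateDist_singleton (t : R → A → R → ℝ) (s : R) (b : A) (r : R) :
    stateDist t s [b] r = t s b r := by
  classical
  simp [stateDist]

/-- The indicator function of a set. -/
noncomputable def ind {α : Type*} (T : Set α) (r : α) : ℝ :=
  open Classical in if r ∈ T then 1 else 0

lemma ind_of_mem {α : Type*} {T : Set α} {r : α} (h : r ∈ T) : ind T r = 1 := by simp [ind, h]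

lemma ind_of_notMem {α : Type*} {T : Set α} {r : α} (h : r ∉ T) : ind T r = 0 := by simp [ind, h]

lemma ind_nonneg {α : Type*} (T : Set α) (r : α) : 0 ≤ ind T r := by
  rw [ind]; split_ifs <;> norm_num

lemma ind_le_one {α : Type*} (T : Set α) (r : α) : ind T r ≤ 1 := by
  rw [ind]; split_ifs <;> norm_num

/-- The probability of being in `T` after reading `v.reverse` from `s`. -/
noncomputable def probIn (t : R → A → R → ℝ) (T : Set R) (s : R) (v : List A) : ℝ :=
  ∑ r, stateDist t s v r * ind T r

lemma probIn_nonneg {t : R → A → R → ℝ} (ht : IsStochastic t) (T : Set R) (s : R) (v : List A) :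
    0 ≤ probIn t T s v :=
  Finset.sum_nonneg fun _ _ => mul_nonneg (stateDist_nonneg ht _ _ _) (ind_nonneg _ _)

lemma probIn_le_one {t : R → A → R → ℝ} (ht : IsStochastic t) (T : Set R) (s : R) (v : List A) :
    probIn t T s v ≤ 1 := by
  rw [← sum_stateDist ht s v]
  refine Finset.sum_le_sum fun _ _ => ?_
  exact mul_le_of_le_one_right (stateDist_nonneg ht _ _ _) (ind_le_one _ _)

lemma probIn_pos_iff {t : R → A → R → ℝ} (ht : IsStochastic t) (T : Set R) (s : R) (v : List A) :
    0 < probIn t T s v ↔ ∃ r ∈ T, 0 < stateDist t s v r := by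
  constructor
  · intro h
    obtain ⟨r, -, hr⟩ := Finset.exists_lt_of_sum_lt (s := Finset.univ) (f := fun _ : R => (0 : ℝ))
      (g := fun r => stateDist t s v r * ind T r) (by simpa [probIn] using h)
    by_cases hT : r ∈ T
    · rw [ind_of_mem hT, mul_one] at hr
      exact ⟨r, hT, hr⟩
    · simp [ind_of_notMem hT] at hr
  · rintro ⟨r, hT, hr⟩
    refine lt_of_lt_of_le (b := stateDist t s v r * ind T r) ?_ ?_
    · rwa [ind_of_mem hT, mul_one]
    · exact Finset.single_le_sum (f := fun r => stateDist t s v r * ind T r)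
        (fun _ _ => mul_nonneg (stateDist_nonneg ht _ _ _) (ind_nonneg _ _)) (Finset.mem_univ r)

/-- Some word leads from `s` to `T` with positive probability. -/
def Reaches (t : R → A → R → ℝ) (T : Set R) (s : R) : Prop := ∃ v, 0 < probIn t T s v

lemma reaches_of_mem {t : R → A → R → ℝ} (ht : IsStochastic t) {T : Set R} {s : R} (h : s ∈ T) :
    Reaches t T s :=
  ⟨[], (probIn_pos_iff ht T s []).2 ⟨s, h, by simp [stateDist]⟩⟩

lemma Reaches.of_step {t : R → A → R → ℝ} (ht : IsStochastic t) {T : Set R} {s s' : R} {b : A}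
    (hs : 0 < t s b s') (h : Reaches t T s') : Reaches t T s := by
  obtain ⟨v, hv⟩ := h
  obtain ⟨r, hr, hpos⟩ := (probIn_pos_iff ht T s' v).1 hv
  refine ⟨v ++ [b], (probIn_pos_iff ht T s _).2 ⟨r, hr, ?_⟩⟩
  refine lt_of_lt_of_le ?_ (mul_le_stateDist_append ht s [b] v s' r)
  rw [stateDist_singleton]
  exact mul_pos hs hpos

/-- If `H` can be reached from everywhere, then a single word visits `H` with probability bounded
below, whatever the initial state. -/
lemma exists_synchronizing_word {t : R → A → R → ℝ} (ht : IsStochastic t) {H : Set R}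
    (hH : ∀ s, Reaches t H s) :
    ∃ (W : List A) (c : ℝ), 0 < c ∧ ∀ s, ∃ v, v <:+ W ∧ c ≤ probIn t H s v := by
  classical
  suffices h : ∀ F : Finset R, ∃ (W : List A) (c : ℝ), 0 < c ∧
      ∀ s ∈ F, ∃ v, v <:+ W ∧ c ≤ probIn t H s v by
    obtain ⟨W, c, hc, hW⟩ := h Finset.univ
    exact ⟨W, c, hc, fun s => hW s (Finset.mem_univ s)⟩
  intro F
  induction F using Finset.induction_on with
  | empty => exact ⟨[], 1, one_pos, by simp⟩
  | insert p F _ ih =>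
    obtain ⟨W, c, hc, hW⟩ := ih
    -- Pick a state `r` where `p` may be after `W`, then a word `v` leading from `r` to `H`. As
    -- words are reversed, `v ++ W` reads `W` first, and what was a suffix of `W` stays a suffix, so
    -- the states already treated are unaffected.
    obtain ⟨r, -, hr⟩ := Finset.exists_lt_of_sum_lt (s := Finset.univ) (f := fun _ : R => (0 : ℝ))
      (g := stateDist t p W) (by simp [sum_stateDist ht])
    obtain ⟨v, hv⟩ := hH r
    obtain ⟨r', hr', hpos⟩ := (probIn_pos_iff ht H r v).1 hv
    have hp : 0 < probIn t H p (v ++ W) := (probIn_pos_iff ht H p _).2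
      ⟨r', hr', (mul_pos hr hpos).trans_le (mul_le_stateDist_append ht p W v r r')⟩
    refine ⟨v ++ W, min c (probIn t H p (v ++ W)), lt_min hc hp, fun s hs => ?_⟩
    rcases Finset.mem_insert.1 hs with rfl | hs
    · exact ⟨_, List.suffix_rfl, min_le_right _ _⟩
    · obtain ⟨u, hu, hcu⟩ := hW s hs
      exact ⟨u, hu.trans (List.suffix_append _ _), (min_le_left _ _).trans hcu⟩

section Discrepancy

/-- The expected discrepancy of the letter `a` among the letters read in states of `T`, when the
word `v.reverse` is read from `s`. -/
noncomputable def expDisc (t : R → A → R → ℝ) (T : Set R) (c : A → ℝ) (s : R) : List A → ℝ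
  | [] => 0
  | b :: v => expDisc t T c s v + probIn t T s v * c b

lemma expDisc_revWindow (t : R → A → R → ℝ) (T : Set R) (c : A → ℝ) (s : R) (X : ℕ → A)
    (n l : ℕ) :
    expDisc t T c s (revWindow X n l) =
      ∑ j ∈ Finset.range l, probIn t T s (revWindow X n j) * c (X (n + j)) := by
  induction l with
  | zero => simp [revWindow, expDisc]
  | succ l ih => rw [Finset.sum_range_succ, ← ih, revWindow, expDisc]

/-- The discrepancy is a martingale in the random letters: its weight `probIn t T s v` depends only
on the earlier letters and `c` is centred, so the cross term vanishes and each letter adds at most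
`1` to the second moment. -/
lemma wordMean_expDisc_sq_le [Fintype A] {t : R → A → R → ℝ} (ht : IsStochastic t) (T : Set R)
    {μ : A → ℝ} (hμ_pos : ∀ a, 0 < μ a) (hμ_sum : ∑ a, μ a = 1) {c : A → ℝ}
    (hc : ∀ a, |c a| ≤ 1) (hc0 : ∑ a, μ a * c a = 0) (s : R) (l : ℕ) :
    wordMean μ l (fun v => expDisc t T c s v ^ 2) ≤ l := by
  induction l with
  | zero => simp [wordMean_zero, expDisc]
  | succ l ih =>
    rw [wordMean_succ]
    have h : ∀ v, ∑ b, μ b * expDisc t T c s (b :: v) ^ 2 ≤ expDisc t T c s v ^ 2 + 1 := by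
      intro v
      have h1 : ∀ b, μ b * expDisc t T c s (b :: v) ^ 2 =
          μ b * expDisc t T c s v ^ 2 + 2 * expDisc t T c s v * probIn t T s v * (μ b * c b) +
            μ b * (probIn t T s v * c b) ^ 2 := fun b => by
        rw [expDisc]; ring
      have h2 : ∑ b, μ b * (probIn t T s v * c b) ^ 2 ≤ 1 := by
        rw [← hμ_sum]
        refine Finset.sum_le_sum fun b _ => mul_le_of_le_one_right (hμ_pos b).le ?_
        rw [← sq_abs, abs_mul, abs_of_nonneg (probIn_nonneg ht _ _ _)]
        exact pow_le_one₀ (mul_nonneg (probIn_nonneg ht _ _ _) (abs_nonneg _))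
          (mul_le_one₀ (probIn_le_one ht _ _ _) (abs_nonneg _) (hc b))
      simp_rw [h1]
      rw [Finset.sum_add_distrib, Finset.sum_add_distrib, ← Finset.sum_mul, ← Finset.mul_sum,
        hμ_sum, hc0]
      linarith
    refine (wordMean_mono hμ_pos l h).trans ?_
    rw [wordMean_add, wordMean_const hμ_sum]
    push_cast
    linarith

end Discrepancy

end Chains

/-! ### Chains driven by a normal sequence. -/

section DrivenChains

variable {A R : Type*} [Fintype R]

/-- The random sequence `s` of states is a Markov chain driven by the letters of `X`, with
transition probabilities `t`: the deviation of `h (s (n + 1))` from its expected value given `s n`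
is orthogonal to functions of the past (of two past states and the present one). -/
structure IsDrivenChain {Ω : Type*} [MeasurableSpace Ω] (ν : Measure Ω) (t : R → A → R → ℝ)
    (X : ℕ → A) (s : ℕ → Ω → R) : Prop where
  measurableSet_eq : ∀ n r, MeasurableSet {ω | s n ω = r}
  integral_eq_zero : ∀ n m m', m ≤ n → m' ≤ n → ∀ (g : R → R → R → ℝ) (h : R → ℝ),
    ∫ ω, g (s m ω) (s m' ω) (s n ω) *
      (h (s (n + 1) ω) - ∑ r, t (s n ω) (X n) r * h r) ∂ν = 0

lemma exists_abs_le (f : R → ℝ) : ∃ C, ∀ r, |f r| ≤ C :=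
  ⟨∑ r, |f r|, fun r => Finset.single_le_sum (f := fun r => |f r|) (fun _ _ => abs_nonneg _)
    (Finset.mem_univ r)⟩

lemma abs_pairing_le {t : R → A → R → ℝ} (ht : IsStochastic t) {h : R → ℝ} {C : ℝ}
    (hC : ∀ r, |h r| ≤ C) (r : R) (b : A) : |∑ r', t r b r' * h r'| ≤ C := by
  refine (Finset.abs_sum_le_sum_abs _ _).trans ?_
  calc ∑ r', |t r b r' * h r'| ≤ ∑ r', t r b r' * C := Finset.sum_le_sum fun r' _ => by
        rw [abs_mul, abs_of_nonneg (ht.nonneg _ _ _)]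
        exact mul_le_mul_of_nonneg_left (hC r') (ht.nonneg _ _ _)
    _ = C := by rw [← Finset.sum_mul, ht.sum_eq_one, one_mul]

variable {Ω : Type*} [MeasurableSpace Ω] {ν : Measure Ω}
  {t : R → A → R → ℝ} {X : ℕ → A} {s : ℕ → Ω → R}

lemma IsDrivenChain.measurable_comp (hs : IsDrivenChain ν t X s) (f : R → ℝ) (n : ℕ) :
    Measurable fun ω => f (s n ω) := by
  let _ : MeasurableSpace R := ⊤
  have : Measurable (s n) := measurable_to_countable' fun r => hs.measurableSet_eq n r
  exact (measurable_from_top (f := f)).comp this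

variable [IsProbabilityMeasure ν]

/-- Functions of the state at a given lag can be replaced, on average, by their conditional
expectations. -/
lemma IsDrivenChain.ae_tendsto_avg_lag (hs : IsDrivenChain ν t X s) (ht : IsStochastic t) (l : ℕ)
    {h : ℕ → R → ℝ} {C : ℝ} (hC : ∀ n r, |h n r| ≤ C) :
    ∀ᵐ ω ∂ν, Tendsto (avg fun n => h n (s (n + l) ω) -
      ∑ r, stateDist t (s n ω) (revWindow X n l) r * h n r) atTop (𝓝 0) := by
  induction l generalizing h with
  | zero =>
    refine Eventually.of_forall fun ω => ?_
    simp only [add_zero, revWindow, stateDist_nil_pairing, sub_self, avg_zero]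
    exact tendsto_const_nhds
  | succ l ih =>
    -- Averaging over the last transition reduces lag `l + 1` to lag `l`, with `h'` in place of `h`.
    set h' : ℕ → R → ℝ := fun n r => ∑ r', t r (X (n + l)) r' * h n r' with hh'
    have hC' : ∀ n r, |h' n r| ≤ C := fun n r => abs_pairing_le ht (hC n) r _
    have h1 : ∀ᵐ ω ∂ν, Tendsto (avg fun n => h n (s (n + l + 1) ω) - h' n (s (n + l) ω)) atTop
        (𝓝 0) := by
      refine ae_tendsto_average_zero (C := C + C)
        (fun n => (hs.measurable_comp _ _).sub (hs.measurable_comp _ _))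
        (fun n ω => (abs_sub _ _).trans (add_le_add (hC _ _) (hC' _ _))) fun m n hmn => ?_
      -- The earlier deviation is a function of the states at times `m + l` and `m + l + 1`, both at
      -- most `n + l`; this is why orthogonality to functions of two past states is required.
      exact hs.integral_eq_zero (n + l) (m + l) (m + l + 1) (by omega) (by omega)
        (fun a b _ => h m b - h' m a) (h n)
    filter_upwards [h1, ih hC'] with ω hω1 hω2
    have h3 := hω1.add hω2
    rw [add_zero] at h3
    refine h3.congr fun M => ?_
    rw [← avg_add]
    congr 1
    funext n
    simp only [revWindow, stateDist_cons_pairing]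
    rw [← add_assoc]
    simp only [hh']
    ring

lemma IsDrivenChain.ae_tendsto_avg_lag_ind (hs : IsDrivenChain ν t X s) (ht : IsStochastic t)
    (T : Set R) {c : A → ℝ} (hc : ∀ a, |c a| ≤ 1) (l : ℕ) :
    ∀ᵐ ω ∂ν, Tendsto (avg fun n => ind T (s (n + l) ω) * c (X (n + l)) -
      probIn t T (s n ω) (revWindow X n l) * c (X (n + l))) atTop (𝓝 0) := by
  have h := hs.ae_tendsto_avg_lag ht l (h := fun n r => ind T r * c (X (n + l))) (C := 1)
    fun n r => by
      rw [abs_mul, abs_of_nonneg (ind_nonneg _ _)]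
      exact mul_le_one₀ (ind_le_one _ _) (abs_nonneg _) (hc _)
  filter_upwards [h] with ω hω
  simpa only [probIn, Finset.sum_mul, mul_assoc] using hω

/-- The discrepancy of the letters read in states of `T` is negligible. -/
theorem IsDrivenChain.ae_tendsto_avg_disc [Fintype A] (hs : IsDrivenChain ν t X s)
    (ht : IsStochastic t) {μ : A → ℝ} (hμ_pos : ∀ a, 0 < μ a) (hμ_sum : ∑ a, μ a = 1)
    (hX : IsNormal μ X) (T : Set R) {c : A → ℝ} (hc : ∀ a, |c a| ≤ 1)
    (hc0 : ∑ a, μ a * c a = 0) :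
    ∀ᵐ ω ∂ν, Tendsto (avg fun n => ind T (s n ω) * c (X n)) atTop (𝓝 0) := by
  have hall := ae_all_iff.2 fun l => hs.ae_tendsto_avg_lag_ind ht T hc l
  filter_upwards [hall] with ω hω
  set x : ℕ → ℝ := fun n => ind T (s n ω) * c (X n) with hx
  have hxC : ∀ n, |x n| ≤ 1 := fun n => by
    rw [abs_mul, abs_of_nonneg (ind_nonneg _ _)]
    exact mul_le_one₀ (ind_le_one _ _) (abs_nonneg _) (hc _)
  have hdisc : ∀ l : ℕ, Tendsto (avg fun n => l * x n -
      expDisc t T c (s n ω) (revWindow X n l)) atTop (𝓝 0) := fun l => by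
    have h1 := tendsto_finsetSum (Finset.range l) fun j _ => hω j
    have h2 := h1.sub (tendsto_avg_sum_shift_sub hxC l)
    simp only [Finset.sum_const_zero, sub_zero] at h2
    refine h2.congr fun M => ?_
    rw [← avg_sum, ← avg_sub]
    congr 1
    funext n
    rw [expDisc_revWindow, Finset.sum_sub_distrib]
    ring
  rw [Metric.tendsto_atTop']
  intro ε hε
  -- Windows have length `k ^ 2`. Their discrepancy averages to at most about `card R * k`, hence
  -- contributes `card R / k < ε / 2` per letter.
  obtain ⟨k, hk⟩ := exists_nat_gt (2 * (Fintype.card R : ℝ) / ε)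
  have hkpos : (0 : ℝ) < k := lt_of_le_of_lt (by positivity) hk
  rw [div_lt_iff₀ hε] at hk
  -- The inequality `|d| ≤ (d ^ 2 + k ^ 2) / (2 * k)` brings in the second moment. The sum over all
  -- starting states makes the bound a function of the window alone, which is what normality
  -- controls.
  set Φ : List A → ℝ := fun v => ∑ r, (expDisc t T c r v ^ 2 + k ^ 2) * (1 / (2 * k)) with hΦ
  have hΦle : ∀ n, |expDisc t T c (s n ω) (revWindow X n (k ^ 2))| ≤
      Φ (revWindow X n (k ^ 2)) := fun n => by
    refine le_trans ?_ (Finset.single_le_sum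
      (f := fun r => (expDisc t T c r (revWindow X n (k ^ 2)) ^ 2 + (k : ℝ) ^ 2) * (1 / (2 * k)))
      (fun _ _ => by positivity) (Finset.mem_univ (s n ω)))
    rw [mul_one_div, le_div_iff₀ (by positivity), ← sq_abs]
    nlinarith [sq_nonneg (|expDisc t T c (s n ω) (revWindow X n (k ^ 2))| - k)]
  have hmean : wordMean μ (k ^ 2) Φ ≤ Fintype.card R * k := by
    simp only [hΦ]
    rw [wordMean_sum]
    refine (Finset.sum_le_sum (g := fun _ => (k : ℝ)) fun r _ => ?_).trans (by simp)
    rw [wordMean_mul_const, wordMean_add, wordMean_const hμ_sum, mul_one_div,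
      div_le_iff₀ (by positivity)]
    have := wordMean_expDisc_sq_le ht T hμ_pos hμ_sum hc hc0 r (k ^ 2)
    push_cast at this
    nlinarith
  have hev1 : ∀ᶠ M in atTop, avg (fun n => Φ (revWindow X n (k ^ 2))) M <
      Fintype.card R * k + k ^ 2 * ε / 4 :=
    (hX.tendsto_avg_window (k ^ 2) Φ).eventually_lt_const
      (lt_of_le_of_lt hmean (by linarith [show (0 : ℝ) < k ^ 2 * ε / 4 by positivity]))
  have hev2 := (tendsto_order.1 (hdisc (k ^ 2)).abs).2 (k ^ 2 * ε / 4)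
    (by rw [abs_zero]; positivity)
  obtain ⟨N, hN⟩ := eventually_atTop.1 (hev1.and hev2)
  refine ⟨N, fun M hM => ?_⟩
  obtain ⟨h1, h2⟩ := hN M hM.le
  rw [Real.dist_eq, sub_zero]
  have h3 : avg (fun n => ((k ^ 2 : ℕ) : ℝ) * x n) M = k ^ 2 * avg x M := by
    rw [mul_comm, ← avg_mul_const]
    simp only [mul_comm, Nat.cast_pow]
  rw [avg_sub, h3] at h2
  have h4 := (abs_avg_le _ M).trans (avg_mono hΦle M)
  have h5 : |(k : ℝ) ^ 2 * avg x M| < Fintype.card R * k + k ^ 2 * ε / 4 + k ^ 2 * ε / 4 := by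
    have h6 := abs_sub_abs_le_abs_sub ((k : ℝ) ^ 2 * avg x M)
      (avg (fun n => expDisc t T c (s n ω) (revWindow X n (k ^ 2))) M)
    linarith
  rw [abs_mul, abs_of_pos (by positivity : (0 : ℝ) < (k : ℝ) ^ 2)] at h5
  have h7 : (k : ℝ) ^ 2 * |avg x M| < k ^ 2 * ε := by nlinarith
  exact lt_of_mul_lt_mul_left h7 (by positivity)

/-- A set of states that can be reached from everywhere is visited with positive lower density. -/
theorem IsDrivenChain.ae_eventually_le_avg_ind [Fintype A] (hs : IsDrivenChain ν t X s)
    (ht : IsStochastic t) {μ : A → ℝ} (hμ_pos : ∀ a, 0 < μ a)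
    (hX : IsNormal μ X) {H : Set R} (hH : ∀ r, Reaches t H r) :
    ∃ κ > 0, ∀ᵐ ω ∂ν, ∀ᶠ M in atTop, κ ≤ avg (fun n => ind H (s n ω)) M := by
  classical
  obtain ⟨W, c, hc, hW⟩ := exists_synchronizing_word ht hH
  set L := W.length with hL
  have hwt := wordWeight_pos hμ_pos W
  -- Occurrences of `W` have density `wordWeight μ W` and contribute `c` each. A visit is counted in
  -- `L + 1` windows, and the factor `2` absorbs the error terms.
  refine ⟨wordWeight μ W * c / (2 * (L + 1)), by positivity, ?_⟩
  have hall := ae_all_iff.2 fun l => hs.ae_tendsto_avg_lag_ind ht H (c := fun _ => 1) (by simp) l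
  filter_upwards [hall] with ω hω
  simp only [mul_one] at hω
  set x : ℕ → ℝ := fun n => ind H (s n ω) with hx
  have hxC : ∀ n, |x n| ≤ 1 := fun n => by
    rw [abs_of_nonneg (ind_nonneg _ _)]
    exact ind_le_one _ _
  have h1 := tendsto_finsetSum (Finset.range (L + 1)) fun j _ => hω j
  have h2 := h1.sub (tendsto_avg_sum_shift_sub hxC (L + 1))
  simp only [Finset.sum_const_zero, sub_zero] at h2
  have h3 := h2.add ((hX.tendsto_avg_window_eq W).mul_const c)
  rw [zero_add] at h3
  have h4 := h3.eventually_const_lt (half_lt_self (mul_pos hwt hc))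
  filter_upwards [h4] with M hM
  have hpt : ∀ n, (if revWindow X n W.length = W then (1 : ℝ) else 0) * c ≤
      ∑ j ∈ Finset.range (L + 1), probIn t H (s n ω) (revWindow X n j) := fun n => by
    split_ifs with hn
    -- When the window reads `W`, the part `v` of `W` suited to the current state is itself a
    -- shorter window from the same starting point, so it supplies one term of the sum.
    · obtain ⟨v, hv, hcv⟩ := hW (s n ω)
      have hvL := hv.length_le
      have hsuf : revWindow X n v.length <:+ W := by
        have := revWindow_suffix X n hvL
        rwa [hn] at this
      have hveq : revWindow X n v.length = v :=
        (List.suffix_of_suffix_length_le hsuf hv (by rw [length_revWindow])).eq_of_length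
          (by rw [length_revWindow])
      rw [one_mul]
      refine hcv.trans ?_
      have := Finset.single_le_sum (f := fun j => probIn t H (s n ω) (revWindow X n j))
        (fun _ _ => probIn_nonneg ht _ _ _)
        (Finset.mem_range.2 (by omega : v.length < L + 1))
      simpa only [hveq] using this
    · rw [zero_mul]
      exact Finset.sum_nonneg fun _ _ => probIn_nonneg ht _ _ _
  have h5 : avg (fun n => ∑ j ∈ Finset.range (L + 1), (x (n + j) -
      probIn t H (s n ω) (revWindow X n j)) -
        (∑ j ∈ Finset.range (L + 1), x (n + j) - ((L + 1 : ℕ) : ℝ) * x n) +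
          (if revWindow X n W.length = W then (1 : ℝ) else 0) * c) M ≤
      avg (fun n => x n * (L + 1)) M := by
    refine avg_mono (fun n => ?_) M
    have := hpt n
    rw [Finset.sum_sub_distrib]
    push_cast
    linarith
  rw [avg_add, avg_sub, avg_sum, avg_mul_const, avg_mul_const] at h5
  have h6 := hM.trans_le h5
  rw [div_le_iff₀ (by positivity)]
  linarith

/-- Testing orthogonality on indicators shows that a transition of probability zero is almost surely
never taken. Hence a path that has lost the ability to reach `T` does not regain it. -/
lemma IsDrivenChain.ae_transition_pos (hs : IsDrivenChain ν t X s) (ht : IsStochastic t) :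
    ∀ᵐ ω ∂ν, ∀ n, 0 < t (s n ω) (X n) (s (n + 1) ω) := by
  classical
  rw [ae_all_iff]
  intro n
  have h : ∀ p r, ∀ᵐ ω ∂ν, s n ω = p → s (n + 1) ω = r → 0 < t p (X n) r := by
    intro p r
    rcases (ht.nonneg p (X n) r).lt_or_eq with hpos | h0
    · exact Eventually.of_forall fun ω _ _ => hpos
    have h1 := hs.integral_eq_zero n n n le_rfl le_rfl
      (fun a _ _ => if a = p then 1 else 0) (fun a => if a = r then 1 else 0)
    have h2 : ∀ ω, (if s n ω = p then (1 : ℝ) else 0) *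
        ((if s (n + 1) ω = r then 1 else 0) -
          ∑ r', t (s n ω) (X n) r' * (if r' = r then 1 else 0)) =
        Set.indicator ({ω | s n ω = p} ∩ {ω | s (n + 1) ω = r}) (fun _ => (1 : ℝ)) ω := by
      intro ω
      by_cases hp : s n ω = p
      · by_cases hr : s (n + 1) ω = r <;> simp [hp, hr, Set.indicator, ← h0]
      · simp [hp, Set.indicator]
    simp_rw [h2] at h1
    rw [integral_indicator_const _ ((hs.measurableSet_eq n p).inter (hs.measurableSet_eq _ r)),
      smul_eq_mul, mul_one, measureReal_eq_zero_iff] at h1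
    rw [ae_iff]
    refine measure_mono_null ?_ h1
    intro ω hω
    simp only [Set.mem_ofPred_eq, Classical.not_imp] at hω
    exact ⟨hω.1, hω.2.1⟩
  have h' : ∀ᵐ ω ∂ν, ∀ p r, s n ω = p → s (n + 1) ω = r → 0 < t p (X n) r := by
    rw [ae_all_iff]
    exact fun p => ae_all_iff.2 (h p)
  filter_upwards [h'] with ω hω
  exact hω _ _ rfl rfl

/-- If a chain is driven by a normal sequence, then a set of states visited infinitely often reads
letters with the right frequencies. -/
theorem IsDrivenChain.ae_finite_or_tendsto_ratio [Fintype A] (hs : IsDrivenChain ν t X s)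
    (ht : IsStochastic t) {μ : A → ℝ} (hμ_pos : ∀ a, 0 < μ a) (hμ_sum : ∑ a, μ a = 1)
    (hX : IsNormal μ X) (T : Set R) (a : A) :
    ∀ᵐ ω ∂ν, {n | s n ω ∈ T}.Infinite →
      Tendsto (fun n : ℕ => (hits (fun k => s k ω ∈ T ∧ X k = a) n : ℝ) /
        hits (fun k => s k ω ∈ T) n) atTop (𝓝 (μ a)) := by
  classical
  -- `T` itself need not be reachable from everywhere; adding the states that cannot reach it
  -- repairs this.
  set H : Set R := T ∪ {r | ¬ Reaches t T r} with hHdef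
  have hH : ∀ r, Reaches t H r := by
    intro r
    by_cases hr : Reaches t T r
    · obtain ⟨v, hv⟩ := hr
      obtain ⟨r', hr', hpos⟩ := (probIn_pos_iff ht T r v).1 hv
      exact ⟨v, (probIn_pos_iff ht H r v).2 ⟨r', Or.inl hr', hpos⟩⟩
    · exact reaches_of_mem ht (Or.inr hr)
  obtain ⟨κ, hκ, hdens⟩ := hs.ae_eventually_le_avg_ind ht hμ_pos hX hH
  have hμ1 : μ a ≤ 1 := by
    rw [← hμ_sum]
    exact Finset.single_le_sum (fun b _ => (hμ_pos b).le) (Finset.mem_univ a)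
  set c : A → ℝ := fun b => (if b = a then 1 else 0) - μ a with hcdef
  have hc : ∀ b, |c b| ≤ 1 := by
    intro b
    have := hμ_pos a
    simp only [hcdef]
    rw [abs_le]
    split_ifs <;> constructor <;> linarith
  have hc0 : ∑ b, μ b * c b = 0 := by
    simp only [hcdef, mul_sub, Finset.sum_sub_distrib, ← Finset.sum_mul, hμ_sum]
    simp
  filter_upwards [hdens, hs.ae_tendsto_avg_disc ht hμ_pos hμ_sum hX T hc hc0,
    hs.ae_transition_pos ht] with ω hω1 hω2 hω3 hinf
  -- Once `T` is unreachable it stays so, contradicting infinitely many visits. Visits to `H` are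
  -- therefore visits to `T`, and the lower density of `H` applies to `T`.
  have hgood : ∀ n, Reaches t T (s n ω) := by
    intro n
    by_contra hn
    have hbad : ∀ k, ¬ Reaches t T (s (n + k) ω) := by
      intro k
      induction k with
      | zero => exact hn
      | succ k ih => exact fun hk => ih (Reaches.of_step ht (hω3 (n + k)) hk)
    refine hinf ((Set.finite_lt_nat n).subset fun m hm => ?_)
    by_contra hmn
    obtain ⟨k, rfl⟩ := Nat.exists_eq_add_of_le (not_lt.1 hmn)
    exact hbad k (reaches_of_mem ht hm)
  have hind : ∀ n, ind H (s n ω) = if s n ω ∈ T then 1 else 0 := by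
    intro n
    have : s n ω ∈ H ↔ s n ω ∈ T := by simp [hHdef, hgood n]
    simp [ind, this]
  simp_rw [hind, ← hits_div_eq_avg] at hω1
  have hdiff : ∀ n, (hits (fun k => s k ω ∈ T ∧ X k = a) n : ℝ) / n -
      μ a * (hits (fun k => s k ω ∈ T) n / n) = avg (fun n => ind T (s n ω) * c (X n)) n := by
    intro n
    rw [hits_div_eq_avg, hits_div_eq_avg, mul_comm, ← avg_mul_const, ← avg_sub]
    congr 1
    funext k
    by_cases h1 : s k ω ∈ T <;> by_cases h2 : X k = a <;> simp [ind, hcdef, h1, h2]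
  rw [← tendsto_sub_nhds_zero_iff]
  have hlim : Tendsto (fun n => |avg (fun n => ind T (s n ω) * c (X n)) n| / κ) atTop (𝓝 0) := by
    simpa using hω2.abs.div_const κ
  refine squeeze_zero_norm' ?_ hlim
  filter_upwards [hω1, eventually_gt_atTop 0] with n hn hn0
  have hn0' : (0 : ℝ) < n := by exact_mod_cast hn0
  have hpos : 0 < (hits (fun k => s k ω ∈ T) n : ℝ) / n := hκ.trans_le hn
  have hne : (hits (fun k => s k ω ∈ T) n : ℝ) ≠ 0 := fun h0 => by simp [h0] at hpos
  have heq : (hits (fun k => s k ω ∈ T ∧ X k = a) n : ℝ) / hits (fun k => s k ω ∈ T) n - μ a =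
      avg (fun n => ind T (s n ω) * c (X n)) n / ((hits (fun k => s k ω ∈ T) n : ℝ) / n) := by
    rw [← hdiff]
    field_simp
  rw [heq, Real.norm_eq_abs, abs_div, abs_of_pos hpos]
  exact div_le_div_of_nonneg_left (abs_nonneg _) hκ hn

end DrivenChains

/-! ### Selectors augmented with a memory of selected letters. -/

section Memory

variable {B : Type*}

/-- Add the letter `x` in front of a word of length at most `K`, keeping only `K` letters. -/
def push (K : ℕ) (x : B) (h : {l : List B // l.length ≤ K}) : {l : List B // l.length ≤ K} :=
  ⟨(x :: h.1).take K, by simp⟩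

lemma push_take (K : ℕ) (x : B) (l : List B) (h : {l : List B // l.length ≤ K})
    (hl : h.1 = l.take K) : (push K x h).1 = (x :: l).take K := by
  cases K with
  | zero => simp [push]
  | succ K => simp [push, hl, List.take_take]

lemma take_length_eq_iff_prefix {v l : List B} : l.take v.length = v ↔ v <+: l := by
  rw [List.prefix_iff_eq_take, eq_comm]

instance finite_memory [Finite B] (K : ℕ) : Finite {l : List B // l.length ≤ K} :=
  (List.finite_length_le B K).to_subtype

end Memory

lemma sum_toReal_pmf {Q : Type*} [Fintype Q] (p : PMF Q) : ∑ q, (p q).toReal = 1 := by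
  have h := p.tsum_coe
  rw [tsum_fintype] at h
  rw [← ENNReal.toReal_sum fun q _ => p.apply_ne_top q, h, ENNReal.toReal_one]

namespace ProbSelector

variable {A Q : Type*}

open Classical in
/-- The update of a state, together with the last `K` selected letters, when the letter `x` is read
and the selector moves to `q'`. -/
noncomputable def augUpdate (S : ProbSelector A Q) (K : ℕ)
    (p : Q × {l : List A // l.length ≤ K}) (x : A) (q' : Q) : Q × {l : List A // l.length ≤ K} :=
  (q', if p.1 ∈ S.sel then push K x p.2 else p.2)

/-- The state of the selector, together with the last `K` selected letters. -/
noncomputable def augState (S : ProbSelector A Q) (X : ℕ → A) (K : ℕ) (n : ℕ)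
    (ω : ℕ × Q × A → Q) : Q × {l : List A // l.length ≤ K} :=
  match n with
  | 0 => (S.init, ⟨[], by simp⟩)
  | n + 1 => S.augUpdate K (S.augState X K n ω) (X n) (ω (n + 1, (S.augState X K n ω).1, X n))

lemma augState_fst (S : ProbSelector A Q) (X : ℕ → A) (K n : ℕ) (ω : ℕ × Q × A → Q) :
    (S.augState X K n ω).1 = S.state X ω n := by
  induction n with
  | zero => rfl
  | succ n ih => simp only [augState, augUpdate, ih, state]

lemma augState_snd (S : ProbSelector A Q) (X : ℕ → A) (K n : ℕ) (ω : ℕ × Q × A → Q) :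
    (S.augState X K n ω).2.1 =
      (revPrefix (S.selected X ω) (hits (· ∈ S.selectedPositions X ω) n)).take K := by
  classical
  induction n with
  | zero => simp [augState, hits_zero, revPrefix]
  | succ n ih =>
    have hmem : (S.augState X K n ω).1 ∈ S.sel ↔ n ∈ S.selectedPositions X ω := by
      rw [augState_fst]; rfl
    rw [hits_succ]
    simp only [augState, augUpdate, hmem]
    by_cases hn : n ∈ S.selectedPositions X ω
    · rw [if_pos hn, if_pos hn, push_take K (X n) _ _ ih, revPrefix]
      have : S.selected X ω (hits (· ∈ S.selectedPositions X ω) n) = X n := by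
        rw [selected, hits]
        exact congrArg X (Nat.nth_count (p := (· ∈ S.selectedPositions X ω)) hn)
      rw [this]
    · rw [if_neg hn, if_neg hn, add_zero, ih]

open Classical in
/-- The transition probabilities of the augmented state. -/
noncomputable def augTrans (S : ProbSelector A Q) (K : ℕ)
    (p : Q × {l : List A // l.length ≤ K}) (x : A) (p' : Q × {l : List A // l.length ≤ K}) : ℝ :=
  if p' = S.augUpdate K p x p'.1 then (S.trans p.1 x p'.1).toReal else 0

/-- The memory is updated deterministically, so a possible successor is determined by its `Q`
component. -/
lemma augTrans_pairing [Fintype Q] (S : ProbSelector A Q) (K : ℕ)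
    [Fintype (Q × {l : List A // l.length ≤ K})]
    (p : Q × {l : List A // l.length ≤ K}) (x : A)
    (h : Q × {l : List A // l.length ≤ K} → ℝ) :
    ∑ p', S.augTrans K p x p' * h p' =
      ∑ q', (S.trans p.1 x q').toReal * h (S.augUpdate K p x q') := by
  classical
  symm
  refine Finset.sum_of_injOn (fun q' => S.augUpdate K p x q') ?_ (by simp) ?_ ?_
  · intro q _ q' _ hqq'
    exact congrArg Prod.fst hqq'
  · intro p' _ hp'
    rw [augTrans, if_neg, zero_mul]
    intro heq
    exact hp' ⟨p'.1, by simp, heq.symm⟩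
  · intro q' _
    simp [augTrans, augUpdate]

lemma isStochastic_augTrans [Fintype Q] (S : ProbSelector A Q) (K : ℕ)
    [Fintype (Q × {l : List A // l.length ≤ K})] : IsStochastic (S.augTrans K) where
  nonneg p x p' := by
    rw [augTrans]; split_ifs
    · exact ENNReal.toReal_nonneg
    · exact le_rfl
  sum_eq_one p x := by
    have h := S.augTrans_pairing K p x fun _ => 1
    simp only [mul_one] at h
    rw [h, sum_toReal_pmf]

instance isProbabilityMeasure_transitionLaw [MeasurableSpace Q] (S : ProbSelector A Q) :
    IsProbabilityMeasure S.transitionLaw := by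
  rw [transitionLaw]; infer_instance

/-- The step from time `n` to `n + 1` uses a transition variable of index `n + 1`, so the variables
of index `n + 1` are independent of the path up to time `n`. -/
lemma dependsOn_augState (S : ProbSelector A Q) (X : ℕ → A) (K n : ℕ) :
    DependsOn (S.augState X K n) {i | i.1 ≤ n} := by
  induction n with
  | zero => exact fun ω ω' _ => rfl
  | succ n ih =>
    intro ω ω' h
    have h1 : S.augState X K n ω = S.augState X K n ω' :=
      ih fun i (hi : i.1 ≤ n) => h i (show i.1 ≤ n + 1 by omega)
    have h2 := h (n + 1, (S.augState X K n ω').1, X n) (le_refl (n + 1))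
    simp only [augState]
    rw [h1]
    exact congrArg _ h2

lemma measurable_of_dependsOn [Finite A] [Finite Q] [MeasurableSpace Q] [DiscreteMeasurableSpace Q]
    {E : Type*} [MeasurableSpace E] [Nonempty E] {f : (ℕ × Q × A → Q) → E} {n : ℕ}
    (hf : DependsOn f {i : ℕ × Q × A | i.1 ≤ n}) : Measurable f := by
  have hfin : {i : ℕ × Q × A | i.1 ≤ n}.Finite :=
    ((Set.finite_le_nat n).prod (Set.finite_univ (α := Q × A))).subset fun i hi => ⟨hi, trivial⟩
  have := hfin.to_subtype
  obtain ⟨g, rfl⟩ := dependsOn_iff_exists_comp.1 hf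
  refine (measurable_of_finite g).comp ?_
  exact measurable_pi_lambda _ fun i => measurable_pi_apply _

/-- A transition is independent of the past. -/
lemma indepFun_transition [Finite A] [Finite Q] [MeasurableSpace Q] [DiscreteMeasurableSpace Q]
    (S : ProbSelector A Q) {E : Type*} [MeasurableSpace E] [Nonempty E]
    {f : (ℕ × Q × A → Q) → E} {n : ℕ}
    (hf : DependsOn f {i : ℕ × Q × A | i.1 ≤ n}) (r : Q) (b : A) :
    IndepFun f (fun ω => ω (n + 1, r, b)) S.transitionLaw := by
  classical
  have hfin : {i : ℕ × Q × A | i.1 ≤ n}.Finite :=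
    ((Set.finite_le_nat n).prod (Set.finite_univ (α := Q × A))).subset fun i hi => ⟨hi, trivial⟩
  have hind : iIndepFun (fun (i : ℕ × Q × A) (ω : ℕ × Q × A → Q) => ω i) S.transitionLaw :=
    iIndepFun_infinitePi (X := fun _ q => q) fun _ => measurable_id
  have hdisj : Disjoint hfin.toFinset {(n + 1, r, b)} := by
    rw [Finset.disjoint_singleton_right]
    simp
  have h := hind.indepFun_finset _ _ hdisj fun i => measurable_pi_apply i
  have hf' : DependsOn f (hfin.toFinset : Set (ℕ × Q × A)) := by
    rwa [hfin.coe_toFinset]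
  obtain ⟨g, rfl⟩ := dependsOn_iff_exists_comp.1 hf'
  exact h.comp (measurable_of_finite g)
    (measurable_pi_apply (⟨(n + 1, r, b), by simp⟩ : ({(n + 1, r, b)} : Finset (ℕ × Q × A))))

lemma integral_transition [Fintype Q] [MeasurableSpace Q] [DiscreteMeasurableSpace Q]
    (S : ProbSelector A Q) (n : ℕ) (r : Q) (b : A) (k : Q → ℝ) :
    ∫ ω, k (ω (n, r, b)) ∂S.transitionLaw = ∑ q, (S.trans r b q).toReal * k q := by
  have h := Measure.infinitePi_map_eval
    (fun i : ℕ × Q × A => (S.trans i.2.1 i.2.2).toMeasure) (n, r, b)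
  have h2 := integral_map (μ := S.transitionLaw) (f := k) (φ := fun ω => ω (n, r, b))
    (measurable_pi_apply _).aemeasurable (Measurable.of_discrete).aestronglyMeasurable
  rw [← h2, transitionLaw]
  erw [h]
  rw [PMF.integral_eq_sum]
  rfl

/-- The transition variable used at time `n` has a random index, as it depends on the current state.
Splitting over the values `p` of that state fixes the index: each summand is a function `G p` of the
past times a centred function of one fresh variable independent of it. -/
lemma isDrivenChain_augState [Finite A] [Fintype Q] [MeasurableSpace Q]
    [DiscreteMeasurableSpace Q] (S : ProbSelector A Q) (X : ℕ → A) (K : ℕ)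
    [Fintype (Q × {l : List A // l.length ≤ K})] :
    IsDrivenChain S.transitionLaw (S.augTrans K) X (S.augState X K) where
  measurableSet_eq n r := by
    let _ : MeasurableSpace (Q × {l : List A // l.length ≤ K}) := ⊤
    have : Nonempty (Q × {l : List A // l.length ≤ K}) := ⟨r⟩
    exact measurable_of_dependsOn (S.dependsOn_augState X K n) (MeasurableSpace.measurableSet_top
      (s := {r}))
  integral_eq_zero n m m' hm hm' g h := by
    classical
    set G : Q × {l : List A // l.length ≤ K} → (ℕ × Q × A → Q) → ℝ := fun p ω =>
      if S.augState X K n ω = p then g (S.augState X K m ω) (S.augState X K m' ω) p else 0 with hG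
    set k : Q × {l : List A // l.length ≤ K} → Q → ℝ := fun p q =>
      h (S.augUpdate K p (X n) q) - ∑ r, S.augTrans K p (X n) r * h r with hk
    have hGdep : ∀ p, DependsOn (G p) {i | i.1 ≤ n} := by
      intro p ω ω' hω
      have h0 := S.dependsOn_augState X K n hω
      have h1 : S.augState X K m ω = S.augState X K m ω' :=
        S.dependsOn_augState X K m fun i (hi : i.1 ≤ m) => hω i (show i.1 ≤ n by omega)
      have h2 : S.augState X K m' ω = S.augState X K m' ω' :=
        S.dependsOn_augState X K m' fun i (hi : i.1 ≤ m') => hω i (show i.1 ≤ n by omega)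
      simp only [hG, h0, h1, h2]
    have hsum : ∀ ω, g (S.augState X K m ω) (S.augState X K m' ω) (S.augState X K n ω) *
        (h (S.augState X K (n + 1) ω) -
          ∑ r, S.augTrans K (S.augState X K n ω) (X n) r * h r) =
        ∑ p, G p ω * k p (ω (n + 1, p.1, X n)) := by
      intro ω
      refine ((Finset.sum_eq_single (S.augState X K n ω) ?_ (by simp)).trans ?_).symm
      · intro p _ hp
        simp only [hG]
        rw [if_neg hp.symm, zero_mul]
      · simp only [hG, hk, if_true]
        rfl
    have hGm : ∀ p, Measurable (G p) := fun p => measurable_of_dependsOn (hGdep p)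
    have hkm : ∀ p, Measurable fun ω : ℕ × Q × A → Q => k p (ω (n + 1, p.1, X n)) := fun p =>
      (Measurable.of_discrete (f := k p)).comp (measurable_pi_apply _)
    have hk0 : ∀ p, ∫ ω, k p (ω (n + 1, p.1, X n)) ∂S.transitionLaw = 0 := by
      intro p
      rw [integral_transition]
      simp only [hk, mul_sub, Finset.sum_sub_distrib, ← Finset.sum_mul]
      rw [sum_toReal_pmf, one_mul, augTrans_pairing, sub_self]
    have hint : ∀ p, Integrable (fun ω => G p ω * k p (ω (n + 1, p.1, X n))) S.transitionLaw := by
      intro p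
      obtain ⟨C, hC⟩ := exists_abs_le (k p)
      obtain ⟨C', hC'⟩ := exists_abs_le fun r : (Q × {l : List A // l.length ≤ K}) ×
        (Q × {l : List A // l.length ≤ K}) => g r.1 r.2 p
      refine integrable_of_measurable_of_bounded ((hGm p).mul (hkm p)) (C := C' * C) fun ω => ?_
      have h0 : 0 ≤ C' := (abs_nonneg _).trans (hC' (p, p))
      rw [abs_mul]
      refine mul_le_mul ?_ (hC _) (abs_nonneg _) h0
      simp only [hG]
      split_ifs
      · exact hC' (_, _)
      · simpa using h0
    simp_rw [hsum]
    rw [integral_finsetSum _ fun p _ => hint p]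
    refine Finset.sum_eq_zero fun p _ => ?_
    have hindep : IndepFun (G p) (fun ω => k p (ω (n + 1, p.1, X n))) S.transitionLaw :=
      (S.indepFun_transition (hGdep p) p.1 (X n)).comp measurable_id
        (Measurable.of_discrete (f := k p))
    rw [hindep.integral_fun_mul_eq_mul_integral (hGm p).aestronglyMeasurable
      (hkm p).aestronglyMeasurable, hk0, mul_zero]

/-- On a normal sequence, a probabilistic selector almost surely selects a finite or a normal
sequence. -/
theorem almostSurelyFiniteOr_isNormal [Fintype A] {μ : A → ℝ} (hμ_pos : ∀ a, 0 < μ a)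
    (hμ_sum : ∑ a, μ a = 1) {X : ℕ → A} (hX : IsNormal μ X) [Finite Q] [MeasurableSpace Q]
    [DiscreteMeasurableSpace Q] (S : ProbSelector A Q) :
    S.AlmostSurelyFiniteOr X (IsNormal μ) := by
  classical
  have := Fintype.ofFinite Q
  -- For each of the countably many `v`, a memory of length `v.length` suffices; `T` consists of the
  -- selecting states whose memory is exactly `v`.
  have hall : ∀ᵐ ω ∂S.transitionLaw, ∀ (v : List A) (a : A),
      {n | (S.augState X v.length n ω).1 ∈ S.sel ∧ (S.augState X v.length n ω).2.1 = v}.Infinite →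
      Tendsto (fun n : ℕ => (hits (fun k => ((S.augState X v.length k ω).1 ∈ S.sel ∧
          (S.augState X v.length k ω).2.1 = v) ∧ X k = a) n : ℝ) /
        hits (fun k => (S.augState X v.length k ω).1 ∈ S.sel ∧
          (S.augState X v.length k ω).2.1 = v) n) atTop (𝓝 (μ a)) := by
    rw [ae_all_iff]
    intro v
    rw [ae_all_iff]
    intro a
    have := Fintype.ofFinite (Q × {l : List A // l.length ≤ v.length})
    exact (S.isDrivenChain_augState X v.length).ae_finite_or_tendsto_ratio
      (S.isStochastic_augTrans v.length) hμ_pos hμ_sum hX {p | p.1 ∈ S.sel ∧ p.2.1 = v} a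
  filter_upwards [hall] with ω hω
  rw [or_iff_not_imp_left]
  intro hinf
  set P : ℕ → Prop := (· ∈ S.selectedPositions X ω) with hP
  have hPinf : {k | P k}.Infinite := hinf
  have hmem : ∀ (v : List A) (n : ℕ),
      ((S.augState X v.length n ω).1 ∈ S.sel ∧ (S.augState X v.length n ω).2.1 = v) ↔
        P n ∧ Ends (S.selected X ω) v (hits P n) := by
    intro v n
    rw [Ends, ← take_length_eq_iff_prefix, ← augState_snd]
    rw [augState_fst]
    rfl
  refine isNormal_of_ratio hμ_pos fun v a hv => ?_
  have h1 := hω v a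
  simp only [hmem] at h1
  have hinf' : {n | P n ∧ Ends (S.selected X ω) v (hits P n)}.Infinite := by
    refine (hv.image (f := Nat.nth P) (Nat.nth_injective hPinf).injOn).mono ?_
    rintro _ ⟨k, hk, rfl⟩
    refine ⟨Nat.nth_mem_of_infinite hPinf k, ?_⟩
    rw [hits_nth hPinf]
    exact hk
  -- Sampling the ratio at the position of the `m`-th selected letter (from `0`), before which
  -- exactly `m` letters have been selected, turns it into a ratio within the selected sequence.
  have h2 := (h1 hinf').comp (Nat.nth_strictMono hPinf).tendsto_atTop
  refine h2.congr fun m => ?_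
  simp only [Function.comp, and_assoc]
  rw [hits_and P fun n => Ends (S.selected X ω) v (hits P n) ∧ X n = a,
    hits_and P fun n => Ends (S.selected X ω) v (hits P n), hits_nth hPinf]
  simp only [hits_nth hPinf]
  rfl

/-! ### Deterministic detectors and the converse implication. -/

/-- The deterministic selector that selects the letters preceded by the word `v.reverse`; letters
are encoded by `e`. -/
noncomputable def detector {N : ℕ} (e : A → Fin N) (v : List A) :
    ProbSelector A {l : List (Fin N) // l.length ≤ v.length} where
  init := ⟨[], by simp⟩
  trans q x := PMF.pure (push v.length (e x) q)
  sel := {q | q.1 = v.map e}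

lemma detector_state {N : ℕ} (e : A → Fin N) (v : List A) (X : ℕ → A) (n : ℕ) :
    ((detector e v).state X (fun i => push v.length (e i.2.2) i.2.1) n).1 =
      ((revPrefix X n).map e).take v.length := by
  induction n with
  | zero => simp [state, detector, revPrefix]
  | succ n ih => rw [state, push_take _ _ _ _ ih, revPrefix, List.map_cons]

/-- A product of Dirac measures is Dirac, so an almost sure statement becomes a statement about a
single run. -/
lemma transitionLaw_detector {N : ℕ} (e : A → Fin N) (v : List A)
    [MeasurableSpace {l : List (Fin N) // l.length ≤ v.length}] :
    (detector e v).transitionLaw =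
      Measure.dirac (fun i => push v.length (e i.2.2) i.2.1) := by
  simp only [transitionLaw, detector, PMF.toMeasure_pure]
  exact Measure.infinitePi_dirac _

/-- If all selectors select finite or balanced sequences from `X`, then `X` is normal. -/
theorem isNormal_of_almostSurelyFiniteOr_isBalanced [Fintype A] {μ : A → ℝ}
    (hμ_pos : ∀ a, 0 < μ a) {X : ℕ → A}
    (h : ∀ (Q : Type) [Finite Q] [MeasurableSpace Q] [DiscreteMeasurableSpace Q]
      (S : ProbSelector A Q), S.AlmostSurelyFiniteOr X (IsBalanced μ)) : IsNormal μ X := by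
  refine isNormal_of_ratio hμ_pos fun v a hv => ?_
  -- The state sets in the hypothesis lie in `Type`, while `A` may live in any universe; the memory
  -- therefore stores codes in `Fin`.
  let e := Fintype.equivFin A
  let _ : MeasurableSpace {l : List (Fin (Fintype.card A)) // l.length ≤ v.length} := ⊤
  have h1 := h _ (detector e v)
  rw [AlmostSurelyFiniteOr, transitionLaw_detector] at h1
  rw [ae_dirac_eq, eventually_pure] at h1
  set ω : ℕ × {l : List (Fin (Fintype.card A)) // l.length ≤ v.length} × A →
    {l : List (Fin (Fintype.card A)) // l.length ≤ v.length} :=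
    fun i => push v.length (e i.2.2) i.2.1 with hω
  have hmem : ∀ n, n ∈ (detector e v).selectedPositions X ω ↔ Ends X v n := by
    intro n
    change ((detector e v).state X ω n).1 = v.map e ↔ _
    rw [hω, detector_state, Ends, ← List.map_take, (List.map_injective_iff.2 e.injective).eq_iff,
      take_length_eq_iff_prefix]
  have hpos : (detector e v).selectedPositions X ω = {n | Ends X v n} := Set.ext hmem
  have hbal := h1.resolve_left (by rw [hpos]; exact hv)
  refine tendsto_ratio_of_tendsto_nth hv (((isBalanced_iff μ _).1 hbal a).congr fun m => ?_)
  simp only [selected, hmem]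

end ProbSelector

end PFA

theorem mainTheorem1 {A : Type*} [Fintype A] (μ : A → ℝ) (hμ_pos : ∀ a, 0 < μ a)
    (hμ_sum : ∑ a, μ a = 1) (X : ℕ → A) :
    List.TFAE
      [PFA.IsNormal μ X,
       ∀ (Q : Type) [Finite Q] [MeasurableSpace Q] [DiscreteMeasurableSpace Q]
         (S : PFA.ProbSelector A Q), S.AlmostSurelyFiniteOr X (PFA.IsBalanced μ),
       ∀ (Q : Type) [Finite Q] [MeasurableSpace Q] [DiscreteMeasurableSpace Q]
         (S : PFA.ProbSelector A Q), S.AlmostSurelyFiniteOr X (PFA.IsNormal μ)] := by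
  tfae_have 1 → 3 := fun hX Q _ _ _ S => S.almostSurelyFiniteOr_isNormal hμ_pos hμ_sum hX
  tfae_have 3 → 2 := fun h Q _ _ _ S =>
    (h Q S).mono fun _ hω => hω.imp_right PFA.IsNormal.isBalanced
  tfae_have 2 → 1 := PFA.ProbSelector.isNormal_of_almostSurelyFiniteOr_isBalanced hμ_pos
  tfae_finish
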